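/- For $n\ge 1$ let $S_n$ be the set of permutations $\sigma=\sigma_1\cdots\sigma_n$ of $\{1,\dots,n\}$. A permutation $\sigma\in S_n$ contains the pattern $\eta\in S_3$ if there are indices $1\le i_1<i_2<i_3\le n$ such that for all $j,k\in\{1,2,3\}$, $\sigma_{i_j}<\sigma_{i_k}$ if and only if $\eta_j<\eta_k$; otherwise $\sigma$ avoids $\eta$. Let $P_n^{\mathrm{av}(\eta)}$ be the uniform probability measure on the set of permutations in $S_n$ that avoid $\eta$. Let $A_n(\sigma)$ be the length of the longest alternating subsequence of $\sigma$, that is, the largest $k$ for which there are indices $1\le i_1<\cdots<i_k\le n$ with $\sigma_{i_1}>\sigma_{i_2}<\sigma_{i_3}>\cdots\sigma_{i_k}$ or $\sigma_{i_1}<\sigma_{i_2}>\sigma_{i_3}<\cdots\sigma_{i_k}$. Theorem. Let $\eta\in S_3$, and let $$I^{\mathrm{alt}}(x)=x\log x+(1-x)\log(1-x)+\log 2,\qquad x\in(0,1).$$ Then $$\lim_{n\to\infty}\frac1n\log P_n^{\mathrm{av}(\eta)}(A_n\ge nx)=\lim_{n\to\infty}\frac1n\log P_n^{\mathrm{av}(\eta)}(A_n>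 nx)=-I^{\mathrm{alt}}(x),\qquad x\in[\tfrac12,1),$$ and $$\lim_{n\to\infty}\frac1n\log P_n^{\mathrm{av}(\eta)}(A_n\le nx)=\lim_{n\to\infty}\frac1n\log P_n^{\mathrm{av}(\eta)}(A_n< nx)=-I^{\mathrm{alt}}(x),\qquad x\in(0,\tfrac12].$$ (In particular, each of these probabilities is positive for all sufficiently large $n$.) -/

import Mathlib

open Filter Topology

/-- A permutation `σ` of `[n]` contains `η` (a permutation of `[m]`) as a pattern if some subsequence
`σ (i 0), …, σ (i (m - 1))` with `i` strictly increasing is in the same relative order as `η`. -/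
def ContainsPattern {n m : ℕ} (σ : Equiv.Perm (Fin n)) (η : Equiv.Perm (Fin m)) : Prop :=
  ∃ i : Fin m → Fin n, StrictMono i ∧ ∀ j k : Fin m, σ (i j) < σ (i k) ↔ η j < η k

/-- The set of permutations of `[n]` that avoid the pattern `η`. -/
def avoiders (n : ℕ) {m : ℕ} (η : Equiv.Perm (Fin m)) : Set (Equiv.Perm (Fin n)) :=
  {σ | ¬ ContainsPattern σ η}

/-- The finite word `w` is alternating and starts with a descent: `w 0 > w 1 < w 2 > ⋯`. -/
def InitiallyDescending {n k : ℕ} (w : Fin k → Fin n) : Prop :=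
  ∀ (j : ℕ) (hj : j + 1 < k),
    (Even j → w ⟨j, by omega⟩ > w ⟨j + 1, hj⟩) ∧ (Odd j → w ⟨j, by omega⟩ < w ⟨j + 1, hj⟩)

/-- The finite word `w` is alternating and starts with an ascent: `w 0 < w 1 > w 2 < ⋯`. -/
def InitiallyAscending {n k : ℕ} (w : Fin k → Fin n) : Prop :=
  ∀ (j : ℕ) (hj : j + 1 < k),
    (Even j → w ⟨j, by omega⟩ < w ⟨j + 1, hj⟩) ∧ (Odd j → w ⟨j, by omega⟩ > w ⟨j + 1, hj⟩)

/-- `σ` has an alternating subsequence (of one of the two types) of length `k`. -/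
def HasAlternatingSubseq {n : ℕ} (σ : Equiv.Perm (Fin n)) (k : ℕ) : Prop :=
  ∃ i : Fin k → Fin n, StrictMono i ∧
    (InitiallyDescending (fun j => σ (i j)) ∨ InitiallyAscending (fun j => σ (i j)))

/-- The length of the longest alternating subsequence of `σ`. The supremum is a maximum:
the lengths are at most `n`, and `0` is one of them. -/
noncomputable def altLength {n : ℕ} (σ : Equiv.Perm (Fin n)) : ℕ :=
  sSup {k : ℕ | HasAlternatingSubseq σ k}

theorem HasAlternatingSubseq.le {n k : ℕ} {σ : Equiv.Perm (Fin n)}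
    (h : HasAlternatingSubseq σ k) : k ≤ n := by
  obtain ⟨i, hi, -⟩ := h
  simpa using Fintype.card_le_of_injective i hi.injective

theorem hasAlternatingSubseq_altLength {n : ℕ} (σ : Equiv.Perm (Fin n)) :
    HasAlternatingSubseq σ (altLength σ) :=
  Nat.sSup_mem (s := {k : ℕ | HasAlternatingSubseq σ k})
    ⟨0, fun j => j.elim0, fun j => j.elim0, Or.inl fun j hj => absurd hj (by omega)⟩
    ⟨n, fun _ h => HasAlternatingSubseq.le h⟩

/-- The probability of the event `E` under the uniform probability measure on the permutations
of `[n]` that avoid `η`. -/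
noncomputable def probAv (n : ℕ) {m : ℕ} (η : Equiv.Perm (Fin m))
    (E : Set (Equiv.Perm (Fin n))) : ℝ :=
  (@ProbabilityTheory.uniformOn (Equiv.Perm (Fin n)) ⊤ (avoiders n η) E).toReal

theorem probAv_eq_ncard_div (n : ℕ) {m : ℕ} (η : Equiv.Perm (Fin m))
    (E : Set (Equiv.Perm (Fin n))) :
    probAv n η E = ((avoiders n η ∩ E).ncard : ℝ) / ((avoiders n η).ncard : ℝ) := by
  let _ : MeasurableSpace (Equiv.Perm (Fin n)) := ⊤
  have _ : MeasurableSingletonClass (Equiv.Perm (Fin n)) := ⟨fun _ => trivial⟩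
  have key : ∀ s : Set (Equiv.Perm (Fin n)),
      MeasureTheory.Measure.count s = ((s.ncard : ℕ) : ENNReal) := by
    intro s
    rw [MeasureTheory.Measure.count_apply_finite s s.toFinite, Set.ncard_eq_toFinset_card s]
  unfold probAv ProbabilityTheory.uniformOn
  rw [ProbabilityTheory.cond_apply (show MeasurableSet (avoiders n η) from trivial), key, key]
  simp [div_eq_inv_mul]

/-- The limit of `(1/n) log (p n)` is `-r`. As `Real.log 0 = 0`, the sequence is also required to be
positive eventually. -/
def HasExpDecayRate (p : ℕ → ℝ) (r : ℝ) : Prop :=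
  (∀ᶠ n : ℕ in atTop, 0 < p n) ∧
    Tendsto (fun n : ℕ => (1 / (n : ℝ)) * Real.log (p n)) atTop (𝓝 (-r))

/-- The rate function, on `(0, 1)`. -/
noncomputable def rateAlt (x : ℝ) : ℝ :=
  x * Real.log x + (1 - x) * Real.log (1 - x) + Real.log 2

/-! By reversal and complementation, which preserve the length of the longest alternating
subsequence, it is enough to treat the patterns 123 and 132. An avoider of either pattern is
determined by its left-to-right minima, hence by two binary words: the indicator of their positions
and the indicator of their values (`sameLRMin_iff`, `SameLRMin.eq_of_avoids_one`,
`SameLRMin.eq_of_avoids_swap`). Not every pair of words occurs, but every pair satisfying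
`StrongBallot` does (`StrongBallot.exists_perm`).

The longest alternating subsequence has two more terms than the ascent sequence has changes
(`altLength_eq`). The ascents of an avoider can be read off the position word, so its number of
letter changes equals the alternating length up to a bounded error. All this is packaged in
`HasBallotCode`.

In a uniform word the changes are independent fair coin tosses, so Cramér's theorem for the fair
coin should give the rate. For the upper bound the ballot condition is dropped and Chernoff's bound
with parameter `x / (1 - x)` is applied to all pairs of words (`ncard_mul_le_of_chernoff`). For the
lower bound the ballot condition must cost only a polynomial factor
(`choose_sq_mul_le_card_strongBallot`): pairs of half length are sorted by imbalance, two with the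
same imbalance are glued after complementing one, the result is rotated into a ballot pair by the
cycle lemma, and padding makes it strong. Each operation alters the number of changes by a bounded
amount. Both bounds have exponent `binEntropy x + log 2`; the number of all avoiders has exponent
`log 4`, and the difference is minus the rate function. -/

/-! ### Binary words and their letter changes -/

/-- The words of length `n` over `Bool`. -/
def words : ℕ → Finset (List Bool)
  | 0 => {[]}
  | n + 1 => (words n).image (List.cons true) ∪ (words n).image (List.cons false)

theorem mem_words {n : ℕ} {l : List Bool} : l ∈ words n ↔ l.length = n := by
  induction n generalizing l with
  | zero => simp [words]
  | succ n ih =>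
    cases l with
    | nil => simp [words]
    | cons x l => cases x <;> simp [words, ih]

theorem sum_words_succ {M : Type*} [AddCommMonoid M] (n : ℕ) (f : List Bool → M) :
    ∑ l ∈ words (n + 1), f l = ∑ l ∈ words n, f (true :: l) + ∑ l ∈ words n, f (false :: l) := by
  rw [words, Finset.sum_union, Finset.sum_image, Finset.sum_image]
  · intro a _ b _ h; simpa using h
  · intro a _ b _ h; simpa using h
  · rw [Finset.disjoint_left]
    intro l h1 h2
    simp only [Finset.mem_image] at h1 h2
    obtain ⟨a, -, rfl⟩ := h1
    obtain ⟨b, -, h⟩ := h2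
    simp at h

theorem card_words (n : ℕ) : (words n).card = 2 ^ n := by
  induction n with
  | zero => simp [words]
  | succ n ih =>
    rw [Finset.card_eq_sum_ones, sum_words_succ, ← Finset.card_eq_sum_ones, ih]
    ring

/-- The number of pairs of adjacent distinct letters of a word. -/
def chg : List Bool → ℕ
  | [] => 0
  | [_] => 0
  | x :: y :: l => (if x = y then 0 else 1) + chg (y :: l)

/-- Once the first letter is fixed, each further letter independently repeats its predecessor
(weight 1) or changes (weight `t`). -/
theorem sum_words_pow_chg (t : ℝ) (n : ℕ) (x : Bool) :
    ∑ l ∈ words n, t ^ chg (x :: l) = (1 + t) ^ n := by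
  induction n generalizing x with
  | zero => simp [words, chg]
  | succ n ih =>
    rw [sum_words_succ]
    cases x <;> simp [chg, pow_add, ← Finset.mul_sum, ih] <;> ring

theorem card_words_chg (n k : ℕ) (x : Bool) :
    ((words n).filter fun l => chg (x :: l) = k).card = n.choose k := by
  induction n generalizing x k with
  | zero =>
    cases k with
    | zero => rw [words, Finset.filter_singleton]; simp [chg]
    | succ k => rw [words, Finset.filter_singleton]; simp [chg]
  | succ n ih =>
    rw [Finset.card_filter, sum_words_succ]
    simp only [← Finset.card_filter] at ih ⊢
    cases k with
    | zero => cases x <;> simp [chg, ih, Nat.add_comm]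
    | succ k =>
      cases x <;>
        simp [chg, ih, Nat.add_comm 1, Nat.choose_succ_succ, Nat.add_comm]

theorem card_words_succ_chg (n k : ℕ) :
    ((words (n + 1)).filter fun l => chg l = k).card = 2 * n.choose k := by
  rw [Finset.card_filter, sum_words_succ]
  simp only [← Finset.card_filter, card_words_chg]
  ring

theorem sum_words_succ_pow_chg (t : ℝ) (n : ℕ) :
    ∑ l ∈ words (n + 1), t ^ chg l = 2 * (1 + t) ^ n := by
  rw [sum_words_succ, sum_words_pow_chg, sum_words_pow_chg]
  ring

theorem chg_append (u v : List Bool) :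
    chg u + chg v ≤ chg (u ++ v) ∧ chg (u ++ v) ≤ chg u + chg v + 1 := by
  induction u with
  | nil => simp [chg]
  | cons x u ih =>
    cases u with
    | nil =>
      cases v with
      | nil => simp [chg]
      | cons y v => simp only [List.cons_append, List.nil_append, chg]; split <;> omega
    | cons y u => simp only [List.cons_append, chg] at ih ⊢; omega

theorem chg_map_not (l : List Bool) : chg (l.map not) = chg l := by
  induction l with
  | nil => rfl
  | cons x l ih =>
    cases l with
    | nil => rfl
    | cons y l =>
      simp only [List.map_cons, chg] at ih ⊢
      rw [ih]
      simp

theorem chg_replicate (j : ℕ) (x : Bool) : chg (List.replicate j x) = 0 := by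
  induction j with
  | zero => rfl
  | succ j ih =>
    cases j with
    | zero => rfl
    | succ j =>
      simp only [List.replicate_succ, chg] at ih ⊢
      simp [ih]

theorem chg_eq_count (l : List Bool) :
    chg l = Nat.count (fun q => l.getD q false ≠ l.getD (q + 1) false) (l.length - 1) := by
  induction l with
  | nil => rfl
  | cons x l ih =>
    cases l with
    | nil => rfl
    | cons y l =>
      rw [chg, ih]
      simp only [List.length_cons, Nat.add_sub_cancel]
      rw [Nat.count_succ']
      simp only [List.getD_cons_succ, List.getD_cons_zero]
      by_cases h : x = y <;> simp [h, Nat.add_comm]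

theorem count_take_eq_natCount (l : List Bool) (p : ℕ) :
    (l.take p).count true = Nat.count (fun q => l.getD q false = true) p := by
  induction l generalizing p with
  | nil => simp [Nat.count_eq_card_filter_range]
  | cons x l ih =>
    cases p with
    | zero => simp
    | succ p =>
      rw [Nat.count_succ', List.take_succ_cons, List.count_cons, ih]
      simp

/-! ### Ballot pairs: the ballot condition costs a polynomial factor -/

/-- The pair `(a, b)` of words encodes a Motzkin path with two kinds of level steps. -/
def Ballot (a b : List Bool) : Prop :=
  a.count true = b.count true ∧ ∀ i, (b.take i).count true ≤ (a.take i).count true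

/-- At each position where `a` has the letter `false`, the path given by `(a, b)` is at positive
height. -/
def StrongBallot (a b : List Bool) : Prop :=
  a.count true = b.count true ∧ ∀ p < a.length, a.getD p false = false →
    (b.take p).count true < (a.take p).count true

/-- The cycle lemma: a closed path stays nonnegative if it is started at a point of minimal height.
-/
theorem exists_ballot_rotate {a b : List Bool} (hl : a.length = b.length)
    (hc : a.count true = b.count true) :
    ∃ r ≤ a.length, Ballot (a.drop r ++ a.take r) (b.drop r ++ b.take r) := by
  obtain ⟨r, hr, hmin⟩ := Finset.exists_min_image (Finset.range (a.length + 1))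
    (fun r => ((a.take r).count true : ℤ) - (b.take r).count true) ⟨0, by simp⟩
  have hr' : r ≤ a.length := by simpa [Nat.lt_succ_iff] using hr
  have hsplit : ∀ (l : List Bool) (i : ℕ), i + r ≤ l.length →
      (((l.drop r).take i).count true : ℤ) = (l.take (r + i)).count true
        - (l.take r).count true := by
    intro l i _
    rw [List.take_add, List.count_append]
    push_cast; ring
  have htot : ∀ l : List Bool, ((l.drop r).count true : ℤ) = l.count true
        - (l.take r).count true := by
    intro l
    conv_rhs => rw [← List.take_append_drop r l, List.count_append]
    push_cast
    simp
  refine ⟨r, hr', ?_, fun i => ?_⟩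
  · have h1 := htot a; have h2 := htot b
    simp only [List.count_append]; omega
  · rw [List.take_append, List.take_append, List.count_append, List.count_append,
      List.length_drop, List.length_drop, List.take_take, List.take_take]
    rcases le_total i (a.length - r) with h | h
    · have e1 := hsplit a i (by omega)
      have e2 := hsplit b i (by omega)
      have := hmin (r + i) (by simp; omega)
      rw [show i - (a.length - r) = 0 by omega, show i - (b.length - r) = 0 by omega]
      simp only [Nat.zero_min, List.take_zero, List.count_nil] at this ⊢
      omega
    · have := hmin (min (i - (a.length - r)) r) (by simp; omega)
      rw [← hl, List.take_of_length_le (l := b.drop r) (by simpa [← hl] using h),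
        List.take_of_length_le (l := a.drop r) (by simpa using h)]
      have e1 := htot a
      have e2 := htot b
      omega

/-- The letters put before `a` raise the path, and those put after `b` restore the balance. As `b`
is thereby read `j` places ahead of `a`, strictness is available only where `a` has `false`, and
this is all that is needed. -/
theorem Ballot.strongBallot {a b : List Bool} (h : Ballot a b) (hl : a.length = b.length)
    {j : ℕ} (hj : 1 ≤ j) :
    StrongBallot (List.replicate j true ++ a) (b ++ List.replicate j true) := by
  refine ⟨by simp [h.1, Nat.add_comm], fun p hp hf => ?_⟩
  have hjp : j ≤ p := by
    by_contra! hlt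
    rw [List.getD_append _ _ _ _ (by simpa using hlt)] at hf
    simp [List.getD_eq_getElem?_getD, hlt] at hf
  obtain ⟨q, rfl⟩ := Nat.exists_eq_add_of_le hjp
  have hq : q < a.length := by simpa using hp
  rw [List.getD_append_right _ _ _ _ (by simp)] at hf
  rw [List.length_replicate, Nat.add_sub_cancel_left] at hf
  rw [List.take_append (l₁ := List.replicate j true), List.count_append, List.length_replicate,
    Nat.add_sub_cancel_left, List.take_of_length_le (l := List.replicate j true) (by simp),
    List.count_replicate_self]
  -- The letter of `a` at `q` is `false`, so the ballot inequality may be used at `q + 1` instead of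
  -- `q`. This leaves only `j - 1` further letters on the side of `b`, one fewer than the `j` gained
  -- by `a`.
  have h1 : (a.take (q + 1)).count true = (a.take q).count true := by
    rw [count_take_eq_natCount, count_take_eq_natCount, Nat.count_succ]
    simp only [hf]; simp
  have h2 := h.2 (q + 1)
  have h3 : ((b ++ List.replicate j true).take (j + q)).count true ≤
      (j - 1) + (b.take (q + 1)).count true := by
    rw [show j + q = (q + 1) + (j - 1) by omega, List.take_add, List.count_append,
      List.take_append_of_le_length (by omega)]
    have := (List.count_le_length (a := true) (l := List.take (j - 1)
      (List.drop (q + 1) (b ++ List.replicate j true)))).trans (List.length_take_le _ _)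
    omega
  omega

-- Rotation to a ballot pair is injective once the rotation amount is recorded, which takes at most
-- `M + 1` values. A rotation exchanges one junction for another, so the number of changes moves by
-- at most one.
open Classical in
theorem card_balanced_le (M lo hi : ℕ) :
    ((words M ×ˢ words M).filter fun p => p.1.count true = p.2.count true ∧
        lo ≤ chg p.1 ∧ chg p.1 ≤ hi).card ≤
      ((words M ×ˢ words M).filter fun p => Ballot p.1 p.2 ∧
        lo ≤ chg p.1 + 1 ∧ chg p.1 ≤ hi + 1).card * (M + 1) := by
  have key : ∀ p : List Bool × List Bool, ∃ r : ℕ, p ∈ ((words M ×ˢ words M).filter fun p =>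
      p.1.count true = p.2.count true ∧ lo ≤ chg p.1 ∧ chg p.1 ≤ hi) → r ≤ M ∧
      Ballot (p.1.drop r ++ p.1.take r) (p.2.drop r ++ p.2.take r) := by
    intro p
    by_cases hp : p ∈ ((words M ×ˢ words M).filter fun p =>
      p.1.count true = p.2.count true ∧ lo ≤ chg p.1 ∧ chg p.1 ≤ hi)
    · simp only [Finset.mem_filter, Finset.mem_product, mem_words] at hp
      obtain ⟨r, hr, h⟩ := exists_ballot_rotate (hp.1.1.trans hp.1.2.symm) hp.2.1
      exact ⟨r, fun _ => ⟨hr.trans hp.1.1.le, h⟩⟩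
    · exact ⟨0, fun h => absurd h hp⟩
  choose r hr using key
  rw [← Finset.card_range (M + 1), ← Finset.card_product]
  refine Finset.card_le_card_of_injOn
    (fun p => ((p.1.drop (r p) ++ p.1.take (r p), p.2.drop (r p) ++ p.2.take (r p)), r p)) ?_ ?_
  · intro p hp
    have h := hr p hp
    simp only [Finset.coe_filter, Finset.mem_product, Set.mem_ofPred_eq, mem_words] at hp
    simp only [Finset.coe_product, Set.mem_prod, Finset.mem_coe, Finset.mem_filter,
      Finset.mem_product, mem_words, Finset.mem_range]
    have e1 := chg_append (p.1.drop (r p)) (p.1.take (r p))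
    have e2 := chg_append (p.1.take (r p)) (p.1.drop (r p))
    rw [List.take_append_drop] at e2
    refine ⟨⟨⟨?_, ?_⟩, h.2, ?_, ?_⟩, by omega⟩
    · simp; omega
    · simp; omega
    · omega
    · omega
  · intro p hp q hq hpq
    have h1 := hr p hp
    have h2 := hr q hq
    simp only [Finset.coe_filter, Finset.mem_product, Set.mem_ofPred_eq, mem_words] at hp hq
    simp only [Prod.mk.injEq] at hpq
    obtain ⟨⟨ha, hb⟩, hc⟩ := hpq
    rw [← hc] at ha hb
    have aux : ∀ u v : List Bool, u.length = v.length →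
        u.drop (r p) ++ u.take (r p) = v.drop (r p) ++ v.take (r p) → u = v := by
      intro u v huv h
      obtain ⟨e1, e2⟩ := List.append_inj h (by simp [huv])
      rw [← List.take_append_drop (r p) u, ← List.take_append_drop (r p) v, e1, e2]
    exact Prod.ext (aux _ _ (hp.1.1.trans hq.1.1.symm) ha) (aux _ _ (hp.1.2.trans hq.1.2.symm) hb)

theorem count_map_not (l : List Bool) : (l.map not).count true = l.count false := by
  induction l with
  | nil => rfl
  | cons x l ih => cases x <;> simp [ih]

/-- Pigeonhole: the statistic is the imbalance of the two words, shifted by `m + 1` to be a natural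
number, and takes at most `2 * m + 3` values. -/
theorem exists_large_fiber (m k : ℕ) : ∃ s : ℕ, m.choose k * 2 ^ m ≤
    ((words (m + 1) ×ˢ words (m + 1)).filter fun p => chg p.1 = k ∧
      p.1.count true + p.2.count false = s).card * (2 * m + 3) := by
  set P := (words (m + 1) ×ˢ words (m + 1)).filter fun p => chg p.1 = k with hP
  have hPc : P.card = 2 * m.choose k * 2 ^ (m + 1) := by
    have : P = ((words (m + 1)).filter fun l => chg l = k) ×ˢ words (m + 1) := by
      ext p; simp [hP]; tauto
    rw [this, Finset.card_product, card_words_succ_chg, card_words]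
  obtain ⟨s, -, hs⟩ := Finset.exists_max_image (Finset.range (2 * m + 3))
    (fun s => (P.filter fun p => p.1.count true + p.2.count false = s).card) ⟨0, by simp⟩
  refine ⟨s, ?_⟩
  have := Finset.card_le_mul_card_image_of_maps_to (s := P) (t := Finset.range (2 * m + 3))
    (f := fun p => p.1.count true + p.2.count false) (fun p hp => ?_) _ hs
  · rw [Finset.card_range, hPc, hP, Finset.filter_filter] at this
    refine le_trans ?_ this
    rw [pow_succ]
    nlinarith [Nat.zero_le (m.choose k * 2 ^ m)]
  · simp only [hP, Finset.mem_filter, Finset.mem_product, mem_words] at hp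
    have h1 := List.count_le_length (a := true) (l := p.1)
    have h2 := List.count_le_length (a := false) (l := p.2)
    simp only [Finset.mem_range]
    omega

/-- Complementing both words of a pair reverses its imbalance and keeps its changes. Gluing a pair
to the complement of another with the same imbalance therefore gives a balanced pair, with one
possible extra change at the junction. -/
theorem sq_card_fiber_le (m k s : ℕ) :
    ((words (m + 1) ×ˢ words (m + 1)).filter fun p => chg p.1 = k ∧
      p.1.count true + p.2.count false = s).card ^ 2 ≤
    ((words (2 * m + 2) ×ˢ words (2 * m + 2)).filter fun p => p.1.count true = p.2.count true ∧
        2 * k ≤ chg p.1 ∧ chg p.1 ≤ 2 * k + 1).card := by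
  rw [sq, ← Finset.card_product]
  refine Finset.card_le_card_of_injOn
    (fun q => (q.1.1 ++ q.2.1.map not, q.1.2 ++ q.2.2.map not)) ?_ ?_
  · rintro ⟨⟨a, b⟩, ⟨c, d⟩⟩ h
    simp only [Finset.coe_product, Set.mem_prod, Finset.mem_coe, Finset.mem_filter,
      Finset.mem_product, mem_words] at h ⊢
    have e := chg_append a (c.map not)
    rw [chg_map_not] at e
    have h1 := List.count_true_add_count_false b
    have h2 := List.count_true_add_count_false c
    have h3 := List.count_true_add_count_false d
    simp only [List.length_append, List.length_map, List.count_append, count_map_not]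
    omega
  · rintro ⟨⟨a, b⟩, ⟨c, d⟩⟩ h ⟨⟨a', b'⟩, ⟨c', d'⟩⟩ h' e
    simp only [Finset.coe_product, Set.mem_prod, Finset.mem_coe, Finset.mem_filter,
      Finset.mem_product, mem_words] at h h'
    simp only [Prod.mk.injEq] at e
    have hinj : Function.Injective (List.map not) :=
      List.map_injective_iff.2 Bool.not_injective
    obtain ⟨e1, e2⟩ := List.append_inj e.1 (by omega)
    obtain ⟨e3, e4⟩ := List.append_inj e.2 (by omega)
    rw [e1, e3, hinj e2, hinj e4]

-- The polynomial loss has three factors of at most `n`: two from squaring the pigeonhole bound and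
-- one from the rotation.
open Classical in
theorem choose_sq_mul_le_card_strongBallot (n k : ℕ) (hn : 3 ≤ n) :
    ((n - 3) / 2).choose k ^ 2 * 4 ^ ((n - 3) / 2) ≤
      ((words n ×ˢ words n).filter fun p => StrongBallot p.1 p.2 ∧
        2 * k ≤ chg p.1 + 1 ∧ chg p.1 ≤ 2 * k + 3).card * n ^ 3 := by
  set m := (n - 3) / 2 with hm
  obtain ⟨s, hs⟩ := exists_large_fiber m k
  have h1 := Nat.pow_le_pow_left hs 2
  have h2 := (sq_card_fiber_le m k s).trans (card_balanced_le (2 * m + 2) (2 * k) (2 * k + 1))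
  have h3 : ((words (2 * m + 2) ×ˢ words (2 * m + 2)).filter fun p => Ballot p.1 p.2 ∧
        2 * k ≤ chg p.1 + 1 ∧ chg p.1 ≤ 2 * k + 1 + 1).card ≤
      ((words n ×ˢ words n).filter fun p => StrongBallot p.1 p.2 ∧
        2 * k ≤ chg p.1 + 1 ∧ chg p.1 ≤ 2 * k + 3).card := by
    -- The padding has length 1 or 2, according to the parity of `n`. It is nonempty because `m` is
    -- half of `n - 3`.
    refine Finset.card_le_card_of_injOn (fun p => (List.replicate (n - (2 * m + 2)) true ++ p.1,
      p.2 ++ List.replicate (n - (2 * m + 2)) true)) ?_ ?_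
    · rintro ⟨a, b⟩ h
      simp only [Finset.coe_filter, Set.mem_ofPred_eq,
        Finset.mem_product, mem_words] at h ⊢
      refine ⟨by simp; omega, h.2.1.strongBallot (by omega) (by omega), ?_⟩
      have e := chg_append (List.replicate (n - (2 * m + 2)) true) a
      rw [chg_replicate] at e
      omega
    · rintro ⟨a, b⟩ - ⟨a', b'⟩ - e
      simpa using e
  have h4 : (2 * m + 3) ≤ n := by omega
  calc m.choose k ^ 2 * 4 ^ m = (m.choose k * 2 ^ m) ^ 2 := by
        rw [mul_pow, ← pow_mul, mul_comm m 2, pow_mul]; norm_num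
    _ ≤ _ := h1
    _ = _ := mul_pow _ _ _
    _ ≤ (_ * (2 * m + 2 + 1)) * (2 * m + 3) ^ 2 := Nat.mul_le_mul_right _ h2
    _ = _ * (2 * m + 3) ^ 3 := by ring
    _ ≤ _ := Nat.mul_le_mul h3 (Nat.pow_le_pow_left h4 3)

/-! ### Longest alternating subsequences and changes of the ascent sequence -/

/-- The one-line notation of `σ`, extended by `0`. -/
def oneLine {n : ℕ} (σ : Equiv.Perm (Fin n)) (q : ℕ) : ℕ :=
  if h : q < n then σ ⟨q, h⟩ else 0

theorem oneLine_val {n : ℕ} (σ : Equiv.Perm (Fin n)) (q : Fin n) : oneLine σ q = σ q := by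
  simp [oneLine]

theorem natCount_congr {P Q : ℕ → Prop} [DecidablePred P] [DecidablePred Q] {m : ℕ}
    (h : ∀ q < m, P q ↔ Q q) : Nat.count P m = Nat.count Q m := by
  induction m with
  | zero => simp
  | succ m ih =>
    rw [Nat.count_succ, Nat.count_succ, ih fun q hq => h q (by omega)]
    simp only [h m (by omega)]

/-- The number of changes of the sequence `e` up to position `m`. -/
def changes (e : ℕ → Bool) (m : ℕ) : ℕ := Nat.count (fun q => e q ≠ e (q + 1)) m

theorem changes_succ (e : ℕ → Bool) (m : ℕ) :
    changes e (m + 1) = changes e m + if e m ≠ e (m + 1) then 1 else 0 :=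
  Nat.count_succ ..

theorem changes_mono (e : ℕ → Bool) : Monotone (changes e) := Nat.count_monotone _

theorem changes_lt_of_ne {e : ℕ → Bool} {p q : ℕ} (hpq : p < q) (h : e p ≠ e q) :
    changes e p < changes e q := by
  induction q, hpq using Nat.le_induction with
  | base => simp [changes_succ, h]
  | succ q hq ih =>
    rw [changes_succ]
    by_cases h' : e p = e q
    · have := changes_mono e (show p ≤ q by omega)
      rw [if_pos (by rw [← h']; exact h)]
      omega
    · have := ih h'
      omega

/-- The pair of positions `x, y` is an ascent of `s` if `d` holds, and a descent otherwise. -/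
def Dir (s : ℕ → ℕ) (d : Bool) (x y : ℕ) : Prop :=
  (d = true → s x < s y) ∧ (d = false → s y < s x)

theorem exists_step_of_dir {s : ℕ → ℕ} {d : Bool} {x y : ℕ} (hxy : x < y) (h : Dir s d x y) :
    ∃ p, x ≤ p ∧ p < y ∧ decide (s p < s (p + 1)) = d := by
  by_contra! hc
  cases d with
  | true =>
    have : ∀ z, x ≤ z → z ≤ y → s z ≤ s x := by
      intro z hz
      induction z, hz using Nat.le_induction with
      | base => intro _; exact le_rfl
      | succ z hz ih =>
        intro hzy
        have := hc z hz (by omega)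
        simp only [ne_eq, decide_eq_true_eq, not_lt] at this
        exact this.trans (ih (by omega))
    exact absurd (h.1 rfl) (not_lt.2 (this y hxy.le le_rfl))
  | false =>
    have : ∀ z, x ≤ z → z ≤ y → s x ≤ s z := by
      intro z hz
      induction z, hz using Nat.le_induction with
      | base => intro _; exact le_rfl
      | succ z hz ih =>
        intro hzy
        have := hc z hz (by omega)
        simp only [ne_eq, decide_eq_false_iff_not, not_not] at this
        exact (ih (by omega)).trans this.le
    exact absurd (h.2 rfl) (not_lt.2 (this y hxy.le le_rfl))

/-- Between two chosen positions some adjacent step goes in the same direction as the chosen pair.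
These adjacent steps alternate, so there is a change of direction between any consecutive two of
them. -/
theorem le_changes_of_alternating {s : ℕ → ℕ} {w : ℕ → ℕ} {d : Bool} {c : ℕ}
    (hw : ∀ j ≤ c, w j < w (j + 1)) (hd : ∀ j ≤ c, Dir s (xor d j.bodd) (w j) (w (j + 1)))
    (j : ℕ) (hj : j ≤ c) :
    ∃ p, w j ≤ p ∧ p < w (j + 1) ∧ decide (s p < s (p + 1)) = xor d j.bodd ∧
      j ≤ changes (fun p => decide (s p < s (p + 1))) p := by
  induction j with
  | zero =>
    obtain ⟨p, h1, h2, h3⟩ := exists_step_of_dir (hw 0 hj) (hd 0 hj)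
    exact ⟨p, h1, h2, h3, Nat.zero_le _⟩
  | succ j ih =>
    obtain ⟨p, h1, h2, h3, h4⟩ := ih (by omega)
    obtain ⟨p', h1', h2', h3'⟩ := exists_step_of_dir (hw _ hj) (hd _ hj)
    refine ⟨p', h1', h2', h3', ?_⟩
    refine Nat.succ_le_of_lt (h4.trans_lt (changes_lt_of_ne (by omega) ?_))
    show decide _ ≠ decide _
    rw [h3, h3', Nat.bodd_succ]
    cases d <;> cases j.bodd <;> simp

/-- The endpoints of the monotone runs form an alternating subsequence. In the induction, a step
that continues the current run moves the last chosen position, and a step that turns adds a new one.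
-/
theorem exists_alternating {s : ℕ → ℕ} (p : ℕ) (hs : ∀ q ≤ p, s q ≠ s (q + 1)) :
    ∃ (w : ℕ → ℕ) (d : Bool) (c : ℕ), c = changes (fun p => decide (s p < s (p + 1))) p ∧
      w (c + 1) = p + 1 ∧ (∀ j ≤ c, w j < w (j + 1)) ∧
      (∀ j ≤ c, Dir s (xor d j.bodd) (w j) (w (j + 1))) ∧
      xor d c.bodd = decide (s p < s (p + 1)) := by
  induction p with
  | zero =>
    refine ⟨id, decide (s 0 < s 1), 0, by simp [changes], rfl, by simp, ?_, by simp⟩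
    intro j hj
    obtain rfl : j = 0 := by omega
    have := hs 0 le_rfl
    simp only [zero_add, Nat.bodd_zero, Bool.xor_false, Dir, id, decide_eq_true_eq, decide_eq_false_iff_not,
      imp_self, true_and] at this ⊢
    omega
  | succ p ih =>
    obtain ⟨w, d, c, hc, hw, h1, h2, h3⟩ := ih fun q hq => hs q (by omega)
    have hne := hs (p + 1) le_rfl
    have hcs := changes_succ (fun p => decide (s p < s (p + 1))) p
    by_cases he : decide (s p < s (p + 1)) = decide (s (p + 1) < s (p + 1 + 1))
    · refine ⟨Function.update w (c + 1) (p + 1 + 1), d, c, ?_, by simp, ?_, ?_, by rw [h3, he]⟩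
      · rw [hcs, if_neg (by simpa using he)]; exact hc
      · intro j hj
        rw [Function.update_of_ne (by omega)]
        have := h1 j hj
        rcases eq_or_ne j c with rfl | hjc
        · rw [Function.update_self]; omega
        · rw [Function.update_of_ne (by omega)]; exact this
      · intro j hj
        rw [Function.update_of_ne (by omega)]
        have := h2 j hj
        rcases eq_or_ne j c with rfl | hjc
        · rw [Function.update_self]
          rw [hw] at this
          rw [h3] at this ⊢
          refine ⟨fun h => ?_, fun h => ?_⟩
          · have h' := this.1 h
            rw [he] at h
            simp only [decide_eq_true_eq] at h
            exact h'.trans h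
          · have h' := this.2 h
            rw [he] at h
            simp only [decide_eq_false_iff_not] at h
            exact lt_of_lt_of_le (lt_of_le_of_ne (not_lt.1 h) hne.symm) h'.le
        · rw [Function.update_of_ne (by omega)]; exact this
    · refine ⟨Function.update w (c + 2) (p + 1 + 1), d, c + 1, ?_, by simp, ?_, ?_, ?_⟩
      · rw [hcs, if_pos (by simpa using he), hc]
      · intro j hj
        rw [Function.update_of_ne (by omega)]
        rcases eq_or_ne j (c + 1) with rfl | hjc
        · rw [Function.update_self]; omega
        · rw [Function.update_of_ne (by omega)]; exact h1 j (by omega)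
      · intro j hj
        rw [Function.update_of_ne (by omega)]
        rcases eq_or_ne j (c + 1) with rfl | hjc
        · rw [Function.update_self, hw, Nat.bodd_succ, Bool.xor_not, h3]
          simp only [Dir, Bool.not_eq_true', Bool.not_eq_false', decide_eq_true_eq,
            decide_eq_false_iff_not]
          simp only [decide_eq_decide] at he
          omega
        · rw [Function.update_of_ne (by omega)]; exact h2 j (by omega)
      · rw [Nat.bodd_succ, Bool.xor_not, h3]
        simp only [decide_eq_decide] at he
        by_cases h : s p < s (p + 1) <;> simp [h] at he ⊢ <;> omega

theorem altLength_le {n k : ℕ} {σ : Equiv.Perm (Fin n)}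
    (h : ∀ j, HasAlternatingSubseq σ j → j ≤ k) : altLength σ ≤ k :=
  h _ (hasAlternatingSubseq_altLength σ)

theorem HasAlternatingSubseq.le_altLength {n k : ℕ} {σ : Equiv.Perm (Fin n)}
    (h : HasAlternatingSubseq σ k) : k ≤ altLength σ :=
  le_csSup ⟨n, fun _ h => HasAlternatingSubseq.le h⟩ h

/-- The ascent sequence of `σ`. -/
def ascents {n : ℕ} (σ : Equiv.Perm (Fin n)) (p : ℕ) : Bool :=
  decide (oneLine σ p < oneLine σ (p + 1))

/-- There is one more monotone run than there are changes of direction, and one more run endpoint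
than there are runs. -/
theorem altLength_eq {n : ℕ} (σ : Equiv.Perm (Fin (n + 2))) :
    altLength σ = changes (ascents σ) n + 2 := by
  apply le_antisymm
  · refine altLength_le fun k hk => ?_
    obtain ⟨i, hi, hk⟩ := hk
    rcases Nat.lt_or_ge k 2 with hk2 | hk2
    · omega
    obtain ⟨c, rfl⟩ := Nat.exists_eq_add_of_le' hk2
    have hex : ∃ d : Bool, ∀ (j : ℕ) (hj : j ≤ c),
        Dir (oneLine σ) (xor d j.bodd) (i ⟨j, by omega⟩) (i ⟨j + 1, by omega⟩) := by
      rcases hk with hk | hk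
      · refine ⟨false, fun j hj => ?_⟩
        have := hk j (by omega)
        simp only [Nat.even_iff, Nat.odd_iff, Nat.mod_two_of_bodd] at this
        simp only [Dir, oneLine_val]
        cases hb : j.bodd <;> simpa [hb] using this
      · refine ⟨true, fun j hj => ?_⟩
        have := hk j (by omega)
        simp only [Nat.even_iff, Nat.odd_iff, Nat.mod_two_of_bodd] at this
        simp only [Dir, oneLine_val]
        cases hb : j.bodd <;> simpa [hb] using this
    obtain ⟨d, hd⟩ := hex
    -- The default value 0 of `w` is never read, since only arguments up to `c + 1` occur.
    obtain ⟨p, hp1, hp2, -, hp⟩ := le_changes_of_alternating (s := oneLine σ) (d := d) (c := c)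
      (w := fun j => if h : j < c + 2 then i ⟨j, h⟩ else 0)
      (fun j hj => by
        rw [dif_pos (by omega), dif_pos (by omega)]
        exact hi (by simp))
      (fun j hj => by
        rw [dif_pos (by omega), dif_pos (by omega)]
        exact hd j hj) c le_rfl
    rw [dif_pos (by omega)] at hp2
    have := (i ⟨c + 1, by omega⟩).2
    have := changes_mono (ascents σ) (show p ≤ n by omega)
    have : c ≤ changes (ascents σ) p := hp
    omega
  · apply HasAlternatingSubseq.le_altLength
    obtain ⟨w, d, c, hc, hw, h1, h2, -⟩ := exists_alternating (s := oneLine σ) n (by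
      intro q hq h
      rw [oneLine, oneLine, dif_pos (by omega), dif_pos (by omega), Fin.val_inj,
        σ.injective.eq_iff] at h
      simp at h)
    rw [show changes (ascents σ) n = c from hc.symm]
    have hmono : ∀ k, k ≤ c + 1 → ∀ j, j < k → w j < w k := by
      intro k
      induction k with
      | zero => intro _ j hj; omega
      | succ k ih =>
        intro hk j hj
        have := h1 k (by omega)
        rcases Nat.lt_succ_iff_lt_or_eq.1 hj with h | rfl
        · exact (ih (by omega) j h).trans this
        · exact this
    have hlt : ∀ j ≤ c + 1, w j < n + 2 := by
      intro j hj
      rcases hj.lt_or_eq with h | rfl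
      · have := hmono (c + 1) le_rfl j h
        omega
      · omega
    refine ⟨fun j => ⟨w j, hlt j (by omega)⟩, fun j k hjk => hmono k (by omega) j hjk, ?_⟩
    have hd : ∀ j (hj : j ≤ c),
        (xor d j.bodd = true → σ ⟨w j, hlt j (by omega)⟩ < σ ⟨w (j + 1), hlt _ (by omega)⟩) ∧
        (xor d j.bodd = false → σ ⟨w (j + 1), hlt _ (by omega)⟩ < σ ⟨w j, hlt j (by omega)⟩) := by
      intro j hj
      have := h2 j hj
      rw [Dir, oneLine, oneLine, dif_pos (hlt j (by omega)), dif_pos (hlt (j + 1) (by omega))] at this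
      exact this
    cases d
    · left
      intro j hj
      have := hd j (by omega)
      simp only [Nat.even_iff, Nat.odd_iff, Nat.mod_two_of_bodd]
      cases hb : j.bodd <;> simpa [hb] using this
    · right
      intro j hj
      have := hd j (by omega)
      simp only [Nat.even_iff, Nat.odd_iff, Nat.mod_two_of_bodd]
      cases hb : j.bodd <;> simpa [hb] using this

/-! ### Reversal and complementation -/

theorem ContainsPattern.reverse {n m : ℕ} {σ : Equiv.Perm (Fin n)} {η : Equiv.Perm (Fin m)}
    (h : ContainsPattern σ η) : ContainsPattern (σ * Fin.revPerm) (η * Fin.revPerm) := by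
  obtain ⟨i, hi, h⟩ := h
  refine ⟨fun j => Fin.rev (i (Fin.rev j)), fun j k hjk => ?_, fun j k => ?_⟩
  · exact Fin.rev_lt_rev.2 (hi (Fin.rev_lt_rev.2 hjk))
  · simp [h]

theorem ContainsPattern.complement {n m : ℕ} {σ : Equiv.Perm (Fin n)} {η : Equiv.Perm (Fin m)}
    (h : ContainsPattern σ η) : ContainsPattern (Fin.revPerm * σ) (Fin.revPerm * η) := by
  obtain ⟨i, hi, h⟩ := h
  exact ⟨i, hi, fun j k => by simp [h]⟩

theorem revPerm_mul_revPerm (n : ℕ) : (Fin.revPerm * Fin.revPerm : Equiv.Perm (Fin n)) = 1 := by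
  ext; simp

theorem mul_revPerm_mem_avoiders {n m : ℕ} {σ : Equiv.Perm (Fin n)} {η : Equiv.Perm (Fin m)} :
    σ * Fin.revPerm ∈ avoiders n η ↔ σ ∈ avoiders n (η * Fin.revPerm) := by
  refine not_congr ⟨fun h => ?_, fun h => ?_⟩
  · simpa [mul_assoc, revPerm_mul_revPerm] using h.reverse
  · simpa [mul_assoc, revPerm_mul_revPerm] using h.reverse

theorem revPerm_mul_mem_avoiders {n m : ℕ} {σ : Equiv.Perm (Fin n)} {η : Equiv.Perm (Fin m)} :
    Fin.revPerm * σ ∈ avoiders n η ↔ σ ∈ avoiders n (Fin.revPerm * η) := by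
  refine not_congr ⟨fun h => ?_, fun h => ?_⟩
  · simpa [← mul_assoc, revPerm_mul_revPerm] using h.complement
  · simpa [← mul_assoc, revPerm_mul_revPerm] using h.complement

theorem HasAlternatingSubseq.complement {n k : ℕ} {σ : Equiv.Perm (Fin n)}
    (h : HasAlternatingSubseq σ k) : HasAlternatingSubseq (Fin.revPerm * σ) k := by
  obtain ⟨i, hi, h⟩ := h
  refine ⟨i, hi, h.symm.imp (fun h j hj => ?_) (fun h j hj => ?_)⟩
  · simpa using h j hj
  · simpa using h j hj

theorem HasAlternatingSubseq.reverse {n k : ℕ} {σ : Equiv.Perm (Fin n)}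
    (h : HasAlternatingSubseq σ k) : HasAlternatingSubseq (σ * Fin.revPerm) k := by
  obtain ⟨i, hi, h⟩ := h
  refine ⟨fun j => Fin.rev (i (Fin.rev j)), fun j k hjk =>
    Fin.rev_lt_rev.2 (hi (Fin.rev_lt_rev.2 hjk)), ?_⟩
  have e1 : ∀ (j : ℕ) (hj : j + 1 < k), (Fin.rev ⟨j, by omega⟩ : Fin k) =
      ⟨(k - 2 - j) + 1, by omega⟩ := by
    intro j hj; ext; simp; omega
  have e2 : ∀ (j : ℕ) (hj : j + 1 < k), (Fin.rev ⟨j + 1, hj⟩ : Fin k) =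
      ⟨(k - 2 - j), by omega⟩ := by
    intro j hj; ext; simp; omega
  rcases Nat.even_or_odd k with hk | hk
  · refine h.symm.imp (fun h j hj => ?_) (fun h j hj => ?_) <;>
    · have := h (k - 2 - j) (by omega)
      simp only [Equiv.Perm.coe_mul, Function.comp, Fin.revPerm_apply, Fin.rev_rev, e1 j hj,
        e2 j hj]
      refine ⟨fun hp => this.1 ?_, fun hp => this.2 ?_⟩
      · rw [Nat.even_iff] at *; omega
      · rw [Nat.even_iff, Nat.odd_iff] at *; omega
  · refine h.imp (fun h j hj => ?_) (fun h j hj => ?_) <;>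
    · have := h (k - 2 - j) (by omega)
      simp only [Equiv.Perm.coe_mul, Function.comp, Fin.revPerm_apply, Fin.rev_rev, e1 j hj,
        e2 j hj]
      refine ⟨fun hp => this.2 ?_, fun hp => this.1 ?_⟩
      · rw [Nat.even_iff, Nat.odd_iff] at *; omega
      · rw [Nat.odd_iff] at *; rw [Nat.even_iff]; omega

theorem altLength_revPerm_mul {n : ℕ} (σ : Equiv.Perm (Fin n)) :
    altLength (Fin.revPerm * σ) = altLength σ := by
  apply le_antisymm
  · refine altLength_le fun k h => HasAlternatingSubseq.le_altLength ?_
    simpa [← mul_assoc, revPerm_mul_revPerm] using h.complement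
  · exact altLength_le fun k h => h.complement.le_altLength

theorem altLength_mul_revPerm {n : ℕ} (σ : Equiv.Perm (Fin n)) :
    altLength (σ * Fin.revPerm) = altLength σ := by
  apply le_antisymm
  · refine altLength_le fun k h => HasAlternatingSubseq.le_altLength ?_
    simpa [mul_assoc, revPerm_mul_revPerm] using h.reverse
  · exact altLength_le fun k h => h.reverse.le_altLength

/-! ### Left-to-right minima -/

/-- The position `p` carries a left-to-right minimum of `σ`. -/
def IsLRMin {n : ℕ} (σ : Equiv.Perm (Fin n)) (p : Fin n) : Prop := ∀ q < p, σ p < σ q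

open Classical in
/-- The indicator word of the positions of the left-to-right minima. -/
noncomputable def minWord {n : ℕ} (σ : Equiv.Perm (Fin n)) : List Bool :=
  List.ofFn fun p => decide (IsLRMin σ p)

open Classical in
/-- The indicator word of the values of the left-to-right minima, in decreasing order of values. -/
noncomputable def minValueWord {n : ℕ} (σ : Equiv.Perm (Fin n)) : List Bool :=
  List.ofFn fun v => decide (IsLRMin σ (σ.symm (Fin.rev v)))

/-- The permutations `σ` and `τ` have the same left-to-right minima. -/
def SameLRMin {n : ℕ} (σ τ : Equiv.Perm (Fin n)) : Prop :=
  ∀ p, (IsLRMin σ p ↔ IsLRMin τ p) ∧ (IsLRMin σ p → σ p = τ p)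

theorem SameLRMin.refl {n : ℕ} (σ : Equiv.Perm (Fin n)) : SameLRMin σ σ :=
  fun _ => ⟨Iff.rfl, fun _ => rfl⟩

theorem SameLRMin.symm {n : ℕ} {σ τ : Equiv.Perm (Fin n)} (h : SameLRMin σ τ) : SameLRMin τ σ :=
  fun p => ⟨(h p).1.symm, fun hp => ((h p).2 ((h p).1.2 hp)).symm⟩

theorem SameLRMin.trans {n : ℕ} {σ τ ρ : Equiv.Perm (Fin n)} (h : SameLRMin σ τ)
    (h' : SameLRMin τ ρ) : SameLRMin σ ρ :=
  fun p => ⟨(h p).1.trans (h' p).1, fun hp => ((h p).2 hp).trans ((h' p).2 ((h p).1.1 hp))⟩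

/-- The values at left-to-right minima decrease from left to right, so the set of positions and the
set of values already determine which value is at which position. -/
theorem sameLRMin_iff {n : ℕ} {σ τ : Equiv.Perm (Fin n)} :
    SameLRMin σ τ ↔ minWord σ = minWord τ ∧ minValueWord σ = minValueWord τ := by
  rw [minWord, minWord, minValueWord, minValueWord, List.ofFn_inj, List.ofFn_inj, funext_iff,
    funext_iff]
  simp only [decide_eq_decide]
  constructor
  · refine fun h => ⟨fun p => (h p).1, fun v => ?_⟩
    generalize Fin.rev v = u
    constructor
    · intro hu
      obtain ⟨h1, h2⟩ := h (σ.symm u)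
      have := h2 hu
      rw [Equiv.apply_symm_apply] at this
      have e : τ.symm u = σ.symm u := by rw [this, Equiv.symm_apply_apply, ← this]
      rw [e]
      exact h1.1 hu
    · intro hu
      obtain ⟨h1, h2⟩ := h.symm (τ.symm u)
      have := h2 hu
      rw [Equiv.apply_symm_apply] at this
      have e : σ.symm u = τ.symm u := by rw [this, Equiv.symm_apply_apply, ← this]
      rw [e]
      exact h1.1 hu
  · rintro ⟨h1, h2⟩ p
    refine ⟨h1 p, fun hp => ?_⟩
    have hanti : ∀ ρ : Equiv.Perm (Fin n), StrictAnti fun p : {p // IsLRMin ρ p} => ρ p :=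
      fun ρ x y hxy => y.2 _ hxy
    have hσ := hanti σ
    have hτ : StrictAnti fun p : {p // IsLRMin σ p} => τ p :=
      fun x y hxy => (h1 _).1 y.2 _ hxy
    have := (hσ.range_inj hτ).1 (by
      ext u
      have := h2 (Fin.rev u)
      rw [Fin.rev_rev] at this
      constructor
      · rintro ⟨⟨x, hx⟩, rfl⟩
        simp only [Equiv.symm_apply_apply] at this
        exact ⟨⟨τ.symm (σ x), (h1 _).2 (this.1 hx)⟩, by simp⟩
      · rintro ⟨⟨x, hx⟩, rfl⟩
        simp only [Equiv.symm_apply_apply] at this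
        exact ⟨⟨σ.symm (τ x), this.2 ((h1 x).1 hx)⟩, by simp⟩)
    exact congrFun this ⟨p, hp⟩

theorem exists_lt_of_not_isLRMin {n : ℕ} {σ : Equiv.Perm (Fin n)} {p : Fin n}
    (h : ¬ IsLRMin σ p) : ∃ q < p, σ q < σ p := by
  simp only [IsLRMin, not_forall, not_lt] at h
  obtain ⟨q, hq, h⟩ := h
  exact ⟨q, hq, lt_of_le_of_ne h fun e => hq.ne (σ.injective e)⟩

theorem containsPattern_one {n : ℕ} {σ : Equiv.Perm (Fin n)} :
    ContainsPattern σ (1 : Equiv.Perm (Fin 3)) ↔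
      ∃ p q r, p < q ∧ q < r ∧ σ p < σ q ∧ σ q < σ r := by
  constructor
  · rintro ⟨i, hi, h⟩
    exact ⟨i 0, i 1, i 2, hi (by decide), hi (by decide), (h 0 1).2 (by decide),
      (h 1 2).2 (by decide)⟩
  · rintro ⟨p, q, r, h1, h2, h3, h4⟩
    refine ⟨![p, q, r], ?_, ?_⟩
    · intro j k hjk
      fin_cases j <;> fin_cases k <;> simp at hjk ⊢
      exacts [h1, h1.trans h2, h2]
    · intro j k
      fin_cases j <;> fin_cases k <;> simp [h3.le, h4.le, h3, h4, h3.trans h4, (h3.trans h4).le]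

theorem containsPattern_swap {n : ℕ} {σ : Equiv.Perm (Fin n)} :
    ContainsPattern σ (Equiv.swap 1 2 : Equiv.Perm (Fin 3)) ↔
      ∃ p q r, p < q ∧ q < r ∧ σ p < σ r ∧ σ r < σ q := by
  constructor
  · rintro ⟨i, hi, h⟩
    exact ⟨i 0, i 1, i 2, hi (by decide), hi (by decide), (h 0 2).2 (by decide),
      (h 2 1).2 (by decide)⟩
  · rintro ⟨p, q, r, h1, h2, h3, h4⟩
    have e0 : (Equiv.swap 1 2 : Equiv.Perm (Fin 3)) 0 = 0 := by decide
    refine ⟨![p, q, r], ?_, ?_⟩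
    · intro j k hjk
      fin_cases j <;> fin_cases k <;> simp at hjk ⊢
      exacts [h1, h1.trans h2, h2]
    · intro j k
      fin_cases j <;> fin_cases k <;>
        simp [h3.le, h4.le, h3, h4, h3.trans h4, (h3.trans h4).le, e0]

/-- Two permutations with the same left-to-right minima agree if they cannot first differ at a
position that carries no left-to-right minimum. -/
theorem SameLRMin.eq_of_forall {n : ℕ} {σ τ : Equiv.Perm (Fin n)} (h : SameLRMin σ τ)
    (H : ∀ p, (∀ q < p, σ q = τ q) → ¬ IsLRMin σ p → ¬ σ p < τ p ∧ ¬ τ p < σ p) : σ = τ := by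
  have : ∀ p, σ p = τ p := by
    intro p
    induction p using WellFoundedLT.induction with
    | ind p ih =>
      by_cases hp : IsLRMin σ p
      · exact (h p).2 hp
      · obtain ⟨h1, h2⟩ := H p ih hp
        exact le_antisymm (not_lt.1 h2) (not_lt.1 h1)
  exact Equiv.ext this

/-- If `σ` and `τ` first differ at the position `p`, then `σ` takes the value `τ p` after `p`. -/
theorem exists_later_position {n : ℕ} {σ τ : Equiv.Perm (Fin n)} {p : Fin n}
    (h : ∀ q < p, σ q = τ q) (hne : σ p ≠ τ p) : ∃ q, p < q ∧ σ q = τ p := by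
  refine ⟨σ.symm (τ p), ?_, by simp⟩
  by_contra! hle
  rcases hle.lt_or_eq with hlt | heq
  · have := h _ hlt
    rw [Equiv.apply_symm_apply, τ.injective.eq_iff] at this
    exact hlt.ne this.symm
  · rw [← heq, Equiv.apply_symm_apply] at hne
    rw [heq] at hne
    exact hne rfl

/-- At the first difference, the permutation with the smaller entry takes the larger one later.
Together with an earlier smaller entry, these two form a 123. -/
theorem SameLRMin.eq_of_avoids_one {n : ℕ} {σ τ : Equiv.Perm (Fin n)} (h : SameLRMin σ τ)
    (hσ : ¬ ContainsPattern σ (1 : Equiv.Perm (Fin 3)))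
    (hτ : ¬ ContainsPattern τ (1 : Equiv.Perm (Fin 3))) : σ = τ := by
  rw [containsPattern_one] at hσ hτ
  refine h.eq_of_forall fun p hp hmin => ⟨fun hlt => hσ ?_, fun hlt => hτ ?_⟩
  · obtain ⟨r, hr, h1⟩ := exists_lt_of_not_isLRMin hmin
    obtain ⟨q, hq, h2⟩ := exists_later_position hp hlt.ne
    exact ⟨r, p, q, hr, hq, h1, by rwa [h2]⟩
  · obtain ⟨r, hr, h1⟩ := exists_lt_of_not_isLRMin ((h p).1.not.1 hmin)
    obtain ⟨q, hq, h2⟩ := exists_later_position (fun q hq => (hp q hq).symm) hlt.ne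
    exact ⟨r, p, q, hr, hq, h1, by rwa [h2]⟩

/-- At the first difference, the permutation with the larger entry takes the smaller one later.
Together with an earlier smaller entry, these two form a 132. -/
theorem SameLRMin.eq_of_avoids_swap {n : ℕ} {σ τ : Equiv.Perm (Fin n)} (h : SameLRMin σ τ)
    (hσ : ¬ ContainsPattern σ (Equiv.swap 1 2 : Equiv.Perm (Fin 3)))
    (hτ : ¬ ContainsPattern τ (Equiv.swap 1 2 : Equiv.Perm (Fin 3))) : σ = τ := by
  rw [containsPattern_swap] at hσ hτ
  refine h.eq_of_forall fun p hp hmin => ⟨fun hlt => hτ ?_, fun hlt => hσ ?_⟩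
  · obtain ⟨r, hr, h1⟩ := exists_lt_of_not_isLRMin hmin
    obtain ⟨q, hq, h2⟩ := exists_later_position (fun q hq => (hp q hq).symm) hlt.ne'
    exact ⟨r, p, q, hr, hq, by rwa [h2, ← hp r hr], by rwa [h2]⟩
  · obtain ⟨r, hr, h1⟩ := exists_lt_of_not_isLRMin ((h p).1.not.1 hmin)
    obtain ⟨q, hq, h2⟩ := exists_later_position hp hlt.ne'
    exact ⟨r, p, q, hr, hq, by rwa [h2, hp r hr], by rwa [h2]⟩

theorem isLRMin_mul_swap_iff {n : ℕ} {σ : Equiv.Perm (Fin n)} {r p q : Fin n} (hrp : r < p)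
    (hpq : p < q) (h1 : σ r < σ p) (h2 : σ r < σ q) (x : Fin n) (hx : IsLRMin σ x) :
    IsLRMin (σ * Equiv.swap p q) x ∧ (σ * Equiv.swap p q) x = σ x := by
  have hxp : x ≠ p := by rintro rfl; exact absurd (hx r hrp) h1.not_gt
  have hxq : x ≠ q := by rintro rfl; exact absurd (hx r (hrp.trans hpq)) h2.not_gt
  have e : (σ * Equiv.swap p q) x = σ x := by
    simp [Equiv.swap_apply_of_ne_of_ne hxp hxq]
  refine ⟨fun y hy => ?_, e⟩
  rw [e]
  rcases eq_or_ne y p with rfl | hyp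
  · simpa using (hx r (hrp.trans hy)).trans h2
  rcases eq_or_ne y q with rfl | hyq
  · simpa using (hx r (hrp.trans (hpq.trans hy))).trans h1
  · simpa [Equiv.swap_apply_of_ne_of_ne hyp hyq] using hx y hy

/-- An earlier smaller entry at `r` keeps both `p` and `q` from carrying a minimum, and also from
affecting whether a later position carries one. -/
theorem sameLRMin_mul_swap {n : ℕ} {σ : Equiv.Perm (Fin n)} {r p q : Fin n} (hrp : r < p)
    (hpq : p < q) (h1 : σ r < σ p) (h2 : σ r < σ q) : SameLRMin σ (σ * Equiv.swap p q) := by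
  intro x
  refine ⟨⟨fun hx => (isLRMin_mul_swap_iff hrp hpq h1 h2 x hx).1, fun hx => ?_⟩,
    fun hx => (isLRMin_mul_swap_iff hrp hpq h1 h2 x hx).2.symm⟩
  have hr : (σ * Equiv.swap p q) r = σ r := by
    simp [Equiv.swap_apply_of_ne_of_ne hrp.ne (hrp.trans hpq).ne]
  have := (isLRMin_mul_swap_iff hrp hpq (by rw [hr]; simpa using h2) (by rw [hr]; simpa using h1)
    x hx).1
  simpa [mul_assoc] using this

theorem toLex_mul_swap_lt {n : ℕ} {σ : Equiv.Perm (Fin n)} {p q : Fin n} (hpq : p < q)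
    (h : σ q < σ p) : toLex (⇑(σ * Equiv.swap p q)) < toLex (⇑σ) := by
  refine ⟨p, fun j hj => ?_, ?_⟩
  · simp [Equiv.swap_apply_of_ne_of_ne hj.ne (hj.trans hpq).ne]
  · simpa using h

theorem lt_toLex_mul_swap {n : ℕ} {σ : Equiv.Perm (Fin n)} {p q : Fin n} (hpq : p < q)
    (h : σ p < σ q) : toLex (⇑σ) < toLex (⇑(σ * Equiv.swap p q)) := by
  refine ⟨p, fun j hj => ?_, ?_⟩
  · simp [Equiv.swap_apply_of_ne_of_ne hj.ne (hj.trans hpq).ne]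
  · simpa using h

/-- Exchanging the last two entries of a 123 keeps the minima and increases the permutation
lexicographically, so a lexicographic maximum in the class has no 123. -/
theorem exists_sameLRMin_avoids_one {n : ℕ} (σ : Equiv.Perm (Fin n)) :
    ∃ τ, SameLRMin σ τ ∧ ¬ ContainsPattern τ (1 : Equiv.Perm (Fin 3)) := by
  classical
  obtain ⟨τ, hτ, hmax⟩ := Finset.exists_max_image
    (Finset.univ.filter fun τ : Equiv.Perm (Fin n) => SameLRMin σ τ)
    (fun τ => toLex (⇑τ)) ⟨σ, Finset.mem_filter.2 ⟨Finset.mem_univ _, .refl σ⟩⟩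
  simp only [Finset.mem_filter, Finset.mem_univ, true_and] at hτ hmax
  refine ⟨τ, hτ, fun h => ?_⟩
  obtain ⟨r, p, q, h1, h2, h3, h4⟩ := containsPattern_one.1 h
  exact absurd (hmax _ (hτ.trans (sameLRMin_mul_swap h1 h2 h3 (h3.trans h4))))
    (lt_toLex_mul_swap h2 h4).not_ge

/-- The same exchange turns a 132 into a 123 and decreases the permutation lexicographically, so
here a minimum is taken. -/
theorem exists_sameLRMin_avoids_swap {n : ℕ} (σ : Equiv.Perm (Fin n)) :
    ∃ τ, SameLRMin σ τ ∧ ¬ ContainsPattern τ (Equiv.swap 1 2 : Equiv.Perm (Fin 3)) := by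
  classical
  obtain ⟨τ, hτ, hmin⟩ := Finset.exists_min_image
    (Finset.univ.filter fun τ : Equiv.Perm (Fin n) => SameLRMin σ τ)
    (fun τ => toLex (⇑τ)) ⟨σ, Finset.mem_filter.2 ⟨Finset.mem_univ _, .refl σ⟩⟩
  simp only [Finset.mem_filter, Finset.mem_univ, true_and] at hτ hmin
  refine ⟨τ, hτ, fun h => ?_⟩
  obtain ⟨r, p, q, h1, h2, h3, h4⟩ := containsPattern_swap.1 h
  exact absurd (hmin _ (hτ.trans (sameLRMin_mul_swap h1 h2 (h3.trans h4) h3)))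
    (toLex_mul_swap_lt h2 h4).not_ge

/-! ### Permutations with prescribed left-to-right minima -/

theorem card_filter_fin_lt {n : ℕ} (P : ℕ → Prop) [DecidablePred P] {p : ℕ} (hp : p ≤ n) :
    (Finset.univ.filter fun q : Fin n => q.1 < p ∧ P q).card = Nat.count P p := by
  rw [Nat.count_eq_card_filter_range]
  refine Finset.card_bij (fun q _ => q.1) ?_ ?_ ?_
  · intro q hq; simpa using hq
  · intro q _ q' _ h; exact Fin.ext h
  · intro q hq
    simp only [Finset.mem_filter, Finset.mem_range] at hq
    exact ⟨⟨q, by omega⟩, by simpa using hq, rfl⟩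

theorem natCount_not_add (P : ℕ → Prop) [DecidablePred P] (p : ℕ) :
    Nat.count (fun q => ¬ P q) p + Nat.count P p = p := by
  induction p with
  | zero => simp
  | succ p ih =>
    rw [Nat.count_succ, Nat.count_succ]
    by_cases h : P p <;> simp [h] <;> omega

theorem exists_perm_strictMono {n : ℕ} (S V : Fin n → Prop) [DecidablePred S] [DecidablePred V]
    (h : Fintype.card {p // S p} = Fintype.card {p // V p}) :
    ∃ π : Equiv.Perm (Fin n), (∀ p, V (π p) ↔ S p) ∧ (∀ p q, (S p ↔ S q) → p < q → π p < π q) := by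
  have h' : Fintype.card {p // ¬ S p} = Fintype.card {p // ¬ V p} := by
    rw [Fintype.card_subtype_compl, Fintype.card_subtype_compl, h]
  let e := (monoEquivOfFin {p // S p} h).symm.trans (monoEquivOfFin {p // V p} rfl)
  let f := (monoEquivOfFin {p // ¬ S p} h').symm.trans (monoEquivOfFin {p // ¬ V p} rfl)
  have he : ∀ p (hp : S p), Equiv.subtypeCongr e.toEquiv f.toEquiv p = e ⟨p, hp⟩ := by
    intro p hp
    simp [Equiv.subtypeCongr, Equiv.sumCompl_symm_apply_of_pos hp]
  have hf : ∀ p (hp : ¬ S p), Equiv.subtypeCongr e.toEquiv f.toEquiv p = f ⟨p, hp⟩ := by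
    intro p hp
    simp [Equiv.subtypeCongr, Equiv.sumCompl_symm_apply_of_neg hp]
  refine ⟨Equiv.subtypeCongr e.toEquiv f.toEquiv, fun p => ?_, fun p q hpq hlt => ?_⟩
  · by_cases hp : S p
    · rw [he p hp]; simp [hp, (e ⟨p, hp⟩).2]
    · rw [hf p hp]; simp [hp, (f ⟨p, hp⟩).2]
  · by_cases hp : S p
    · rw [he p hp, he q (hpq.1 hp)]
      exact e.strictMono (show (⟨p, hp⟩ : {p // S p}) < ⟨q, _⟩ from hlt)
    · rw [hf p hp, hf q (hpq.not.1 hp)]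
      exact f.strictMono (show (⟨p, hp⟩ : {p // ¬ S p}) < ⟨q, _⟩ from hlt)

/-- The positions marked by `a` receive the values marked by `b` in decreasing order, and the other
positions receive the other values, also in decreasing order. The strong ballot condition puts a
smaller marked entry before every unmarked one. The work is done with `π`, the complement of this
permutation, which is increasing on both classes. -/
theorem StrongBallot.exists_perm {n : ℕ} {a b : List Bool} (ha : a.length = n) (hb : b.length = n)
    (h : StrongBallot a b) :
    ∃ σ : Equiv.Perm (Fin n), minWord σ = a ∧ minValueWord σ = b := by
  set S : ℕ → Prop := fun q => a.getD q false = true with hS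
  set V : ℕ → Prop := fun q => b.getD q false = true with hV
  have hlt : ∀ p < n, ¬ S p → Nat.count V p < Nat.count S p := by
    intro p hp hn
    rw [← count_take_eq_natCount, ← count_take_eq_natCount]
    exact h.2 p (by omega) (by simpa [hS] using hn)
  have hcard : ∀ P : ℕ → Prop, ∀ [DecidablePred P],
      Fintype.card {p : Fin n // P p} = Nat.count P n := by
    intro P _
    rw [Fintype.card_subtype, ← card_filter_fin_lt P le_rfl]
    simp
  obtain ⟨π, hπ, hmono⟩ := exists_perm_strictMono (n := n) (fun p => S p) (fun p => V p) (by
    rw [hcard S, hcard V, ← count_take_eq_natCount, ← count_take_eq_natCount,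
      List.take_of_length_le ha.le, List.take_of_length_le hb.le, h.1])
  -- Otherwise `π p` exceeds all earlier entries. Then `p ≤ π p`, and the unmarked values below `π
  -- p` all come from unmarked positions before `p`. Too few such positions exist, because fewer
  -- letters are marked in `b` than in `a` before `p`.
  have hex : ∀ p : Fin n, ¬ S p → ∃ r < p, S r ∧ π p < π r := by
    intro p hp
    by_contra! hc
    have hall : ∀ q < p, π q < π p := by
      intro q hq
      by_cases hqS : S q
      · exact lt_of_le_of_ne (hc q hq hqS) fun e => hq.ne (π.injective e)
      · exact hmono q p (by simp [hqS, hp]) hq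
    have h1 : p.1 ≤ (π p).1 := by
      have := Finset.card_le_card_of_injOn (s := Finset.Iio p) (t := Finset.Iio (π p)) π
        (fun q hq => by simpa using hall q (by simpa using hq)) π.injective.injOn
      simpa using this
    have h2 : Nat.count (fun q => ¬ V q) (π p) ≤ Nat.count (fun q => ¬ S q) p := by
      rw [← card_filter_fin_lt _ (π p).2.le, ← card_filter_fin_lt _ p.2.le]
      refine Finset.card_le_card_of_injOn π.symm (fun v hv => ?_) π.symm.injective.injOn
      simp only [Finset.coe_filter, Finset.mem_univ, true_and, Set.mem_ofPred_eq] at hv ⊢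
      have hvS : ¬ S (π.symm v) := by
        rw [← hπ, Equiv.apply_symm_apply]; exact hv.2
      refine ⟨?_, hvS⟩
      by_contra! hle
      rcases (show p ≤ π.symm v from hle).lt_or_eq with hl | he
      · have := hmono _ _ (by simp [hvS, hp]) hl
        rw [Equiv.apply_symm_apply] at this
        exact absurd hv.1 this.not_gt
      · rw [he, Equiv.apply_symm_apply] at hv
        exact absurd hv.1 (lt_irrefl _)
    have h3 := natCount_not_add V (π p)
    have h4 := natCount_not_add S p
    have h5 := hlt p p.2 hp
    have h6 : Nat.count V (π p) ≤ Nat.count V p + ((π p).1 - p.1) := by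
      obtain ⟨d, hd⟩ := Nat.exists_eq_add_of_le h1
      rw [hd, Nat.count_add, Nat.add_sub_cancel_left]
      exact Nat.add_le_add_left (Nat.count_le _) _
    omega
  have hmin : ∀ p, IsLRMin (π.trans Fin.revPerm) p ↔ S p := by
    intro p
    constructor
    · intro hp
      by_contra hpS
      obtain ⟨r, hr, -, hlt⟩ := hex p hpS
      have := hp r hr
      simp at this
      exact absurd this hlt.not_gt
    · intro hp q hq
      simp only [Equiv.trans_apply, Fin.revPerm_apply, Fin.rev_lt_rev]
      by_cases hqS : S q
      · exact hmono q p (by simp [hqS, hp]) hq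
      · obtain ⟨r, hr, hrS, hlt⟩ := hex q hqS
        exact hlt.trans (hmono r p (by simp [hrS, hp]) (hr.trans hq))
  refine ⟨π.trans Fin.revPerm, ?_, ?_⟩
  · refine List.ext_getElem (by simp [minWord, ha]) fun i h1 h2 => ?_
    simp only [minWord, List.getElem_ofFn, hmin]
    simp [hS, h2]
  · refine List.ext_getElem (by simp [minValueWord, hb]) fun i h1 h2 => ?_
    simp only [minValueWord, List.getElem_ofFn, hmin, ← hπ]
    simp [hV, h2]

/-! ### Reading the ascents of an avoider off its word of minima -/

theorem minWord_getD {n : ℕ} (σ : Equiv.Perm (Fin n)) (q : ℕ) :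
    (minWord σ).getD q false = true ↔ ∃ h : q < n, IsLRMin σ ⟨q, h⟩ := by
  rw [List.getD_eq_getElem?_getD, minWord, List.getElem?_ofFn]
  by_cases h : q < n <;> simp [h]

theorem chg_minWord {n : ℕ} (σ : Equiv.Perm (Fin (n + 2))) :
    chg (minWord σ) = changes (fun q => (minWord σ).getD q false) (n + 1) := by
  rw [chg_eq_count, minWord, List.length_ofFn]
  rfl

/-- A descent to an entry that is not a left-to-right minimum would complete a 132 with a smaller
earlier entry. -/
theorem ascents_eq_of_avoids_swap {n : ℕ} {σ : Equiv.Perm (Fin n)}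
    (hσ : ¬ ContainsPattern σ (Equiv.swap 1 2 : Equiv.Perm (Fin 3))) {q : ℕ} (hq : q + 1 < n) :
    ascents σ q = !(minWord σ).getD (q + 1) false := by
  rw [containsPattern_swap] at hσ
  rw [Bool.eq_iff_iff, Bool.not_eq_true', ← Bool.not_eq_true, minWord_getD, ascents,
    decide_eq_true_eq, oneLine, oneLine, dif_pos hq, dif_pos (by omega)]
  constructor
  · rintro hlt ⟨_, hmin⟩
    exact absurd (hmin ⟨q, by omega⟩ (Nat.lt_succ_self q)) (not_lt.2 (le_of_lt hlt))
  · intro hn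
    obtain ⟨r, hr, hlt⟩ := exists_lt_of_not_isLRMin (p := ⟨q + 1, hq⟩) fun h => hn ⟨hq, h⟩
    rcases (show r ≤ ⟨q, by omega⟩ from Nat.le_of_lt_succ hr).lt_or_eq with h | h
    · by_contra hle
      refine hσ ⟨r, ⟨q, by omega⟩, ⟨q + 1, hq⟩, h, Nat.lt_succ_self q, hlt, ?_⟩
      refine lt_of_le_of_ne (not_lt.1 hle) fun e => ?_
      simpa using σ.injective e
    · rwa [h] at hlt

/-- An ascent starting from an entry that is not a left-to-right minimum would complete a 123. -/
theorem ascents_eq_of_avoids_one {n : ℕ} {σ : Equiv.Perm (Fin n)}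
    (hσ : ¬ ContainsPattern σ (1 : Equiv.Perm (Fin 3))) {q : ℕ} (hq : q + 1 < n) :
    ascents σ q = ((minWord σ).getD q false && !(minWord σ).getD (q + 1) false) := by
  rw [containsPattern_one] at hσ
  rw [Bool.eq_iff_iff, Bool.and_eq_true, Bool.not_eq_true', ← Bool.not_eq_true, minWord_getD,
    minWord_getD, ascents, decide_eq_true_eq, oneLine, oneLine, dif_pos hq, dif_pos (by omega)]
  constructor
  · refine fun hlt => ⟨⟨by omega, ?_⟩, ?_⟩
    · by_contra hn
      obtain ⟨r, hr, h⟩ := exists_lt_of_not_isLRMin hn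
      exact hσ ⟨r, ⟨q, by omega⟩, ⟨q + 1, hq⟩, hr, Nat.lt_succ_self q, h, hlt⟩
    · rintro ⟨_, hmin⟩
      exact absurd (hmin ⟨q, by omega⟩ (Nat.lt_succ_self q)) (not_lt.2 (le_of_lt hlt))
  · rintro ⟨⟨hq', hmin⟩, hn⟩
    obtain ⟨r, hr, hlt⟩ := exists_lt_of_not_isLRMin (p := ⟨q + 1, hq⟩) fun h => hn ⟨hq, h⟩
    rcases (show r ≤ ⟨q, by omega⟩ from Nat.le_of_lt_succ hr).lt_or_eq with h | h
    · exact (hmin r h).trans hlt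
    · rwa [h] at hlt

theorem changes_congr {e f : ℕ → Bool} {m : ℕ} (h : ∀ q ≤ m, e q = f q) :
    changes e m = changes f m :=
  natCount_congr fun q hq => by rw [h q hq.le, h (q + 1) hq]

theorem changes_not_succ (a : ℕ → Bool) (m : ℕ) :
    changes (fun q => !a (q + 1)) m ≤ changes a (m + 1) ∧
      changes a (m + 1) ≤ changes (fun q => !a (q + 1)) m + 1 := by
  induction m with
  | zero => rw [changes_succ]; simp only [changes, Nat.count_zero]; split <;> simp
  | succ m ih =>
    rw [changes_succ _ m, changes_succ _ (m + 1)]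
    have : ((!a (m + 1)) ≠ !a (m + 1 + 1)) ↔ a (m + 1) ≠ a (m + 1 + 1) := by simp
    simp only [this]
    omega

/-- Each passage from `true` to `false` is an isolated `true` of the new sequence and so contributes
two changes. In `a` such passages alternate with those from `false` to `true`, so the totals agree
up to the boundary terms, which make the induction exact. -/
theorem changes_peaks (a : ℕ → Bool) (m : ℕ) :
    changes (fun q => a q && !a (q + 1)) m + (if a 0 = true ∧ a 1 = true then 0 else 1) =
      changes a m + (if a m = true ∧ a (m + 1) = true then 0 else 1) := by
  induction m with
  | zero => simp [changes]
  | succ m ih =>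
    rw [changes_succ, changes_succ]
    cases h1 : a m <;> cases h2 : a (m + 1) <;> cases h3 : a (m + 1 + 1) <;>
      simp [h1, h2] at ih ⊢ <;> omega

/-! ### Ballot codes for the six patterns -/

/-- The permutations avoiding `η` are encoded by pairs of words, in such a way that all strong
ballot pairs are codes and that the number of changes of the first word approximates the length of
the longest alternating subsequence. -/
def HasBallotCode (η : Equiv.Perm (Fin 3)) : Prop :=
  ∀ n, ∃ code : Equiv.Perm (Fin (n + 2)) → List Bool × List Bool,
    Set.InjOn code (avoiders (n + 2) η) ∧
    (∀ σ ∈ avoiders (n + 2) η, code σ ∈ words (n + 2) ×ˢ words (n + 2) ∧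
      chg (code σ).1 ≤ altLength σ + 3 ∧ altLength σ ≤ chg (code σ).1 + 3) ∧
    ∀ p ∈ words (n + 2) ×ˢ words (n + 2), StrongBallot p.1 p.2 →
      ∃ σ ∈ avoiders (n + 2) η, code σ = p

theorem hasBallotCode_of_sameLRMin {η : Equiv.Perm (Fin 3)}
    (hinj : ∀ n, ∀ σ ∈ avoiders n η, ∀ τ ∈ avoiders n η, SameLRMin σ τ → σ = τ)
    (hex : ∀ n, ∀ σ : Equiv.Perm (Fin n), ∃ τ ∈ avoiders n η, SameLRMin σ τ)
    (halt : ∀ n, ∀ σ ∈ avoiders (n + 2) η,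
      chg (minWord σ) ≤ altLength σ + 3 ∧ altLength σ ≤ chg (minWord σ) + 3) :
    HasBallotCode η := by
  intro n
  refine ⟨fun σ => (minWord σ, minValueWord σ), fun σ hσ τ hτ h => ?_, fun σ hσ => ⟨?_, halt n σ hσ⟩,
    fun p hp hb => ?_⟩
  · exact hinj _ σ hσ τ hτ (sameLRMin_iff.2 (by simpa using h))
  · simp [mem_words, minWord, minValueWord]
  · rw [Finset.mem_product, mem_words, mem_words] at hp
    obtain ⟨σ, h1, h2⟩ := hb.exists_perm hp.1 hp.2
    obtain ⟨τ, hτ, h⟩ := hex _ σ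
    rw [sameLRMin_iff] at h
    exact ⟨τ, hτ, Prod.ext (h.1.symm.trans h1) (h.2.symm.trans h2)⟩

theorem hasBallotCode_one : HasBallotCode 1 := by
  refine hasBallotCode_of_sameLRMin (fun n σ hσ τ hτ h => h.eq_of_avoids_one hσ hτ)
    (fun n σ => ?_) fun n σ hσ => ?_
  · obtain ⟨τ, h1, h2⟩ := exists_sameLRMin_avoids_one σ
    exact ⟨τ, h2, h1⟩
  · rw [altLength_eq, chg_minWord, changes_congr (e := ascents σ) fun q hq =>
      ascents_eq_of_avoids_one hσ (show q + 1 < n + 2 by omega)]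
    have h1 := changes_peaks (fun q => (minWord σ).getD q false) n
    have h2 := changes_succ (fun q => (minWord σ).getD q false) n
    split_ifs at h1 h2 <;> omega

theorem hasBallotCode_swap : HasBallotCode (Equiv.swap 1 2) := by
  refine hasBallotCode_of_sameLRMin (fun n σ hσ τ hτ h => h.eq_of_avoids_swap hσ hτ)
    (fun n σ => ?_) fun n σ hσ => ?_
  · obtain ⟨τ, h1, h2⟩ := exists_sameLRMin_avoids_swap σ
    exact ⟨τ, h2, h1⟩
  · rw [altLength_eq, chg_minWord, changes_congr (e := ascents σ) fun q hq =>
      ascents_eq_of_avoids_swap hσ (show q + 1 < n + 2 by omega)]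
    have := changes_not_succ (fun q => (minWord σ).getD q false) n
    omega

theorem HasBallotCode.mul_revPerm {η : Equiv.Perm (Fin 3)} (h : HasBallotCode η) :
    HasBallotCode (η * Fin.revPerm) := by
  intro n
  obtain ⟨code, h1, h2, h3⟩ := h n
  refine ⟨fun σ => code (σ * Fin.revPerm), fun σ hσ τ hτ e => ?_, fun σ hσ => ?_, fun p hp hb => ?_⟩
  · exact mul_right_cancel
      (h1 (mul_revPerm_mem_avoiders.2 hσ) (mul_revPerm_mem_avoiders.2 hτ) e)
  · simpa only [altLength_mul_revPerm] using h2 _ (mul_revPerm_mem_avoiders.2 hσ)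
  · obtain ⟨σ, hσ, e⟩ := h3 p hp hb
    have hrr : σ * Fin.revPerm * Fin.revPerm = σ := by
      rw [mul_assoc, revPerm_mul_revPerm, mul_one]
    exact ⟨σ * Fin.revPerm, mul_revPerm_mem_avoiders.1 (hrr.symm ▸ hσ), by simp only [hrr, e]⟩

theorem HasBallotCode.revPerm_mul {η : Equiv.Perm (Fin 3)} (h : HasBallotCode η) :
    HasBallotCode (Fin.revPerm * η) := by
  intro n
  obtain ⟨code, h1, h2, h3⟩ := h n
  refine ⟨fun σ => code (Fin.revPerm * σ), fun σ hσ τ hτ e => ?_, fun σ hσ => ?_, fun p hp hb => ?_⟩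
  · exact mul_left_cancel
      (h1 (revPerm_mul_mem_avoiders.2 hσ) (revPerm_mul_mem_avoiders.2 hτ) e)
  · simpa only [altLength_revPerm_mul] using h2 _ (revPerm_mul_mem_avoiders.2 hσ)
  · obtain ⟨σ, hσ, e⟩ := h3 p hp hb
    have hrr : Fin.revPerm * (Fin.revPerm * σ) = σ := by
      rw [← mul_assoc, revPerm_mul_revPerm, one_mul]
    exact ⟨Fin.revPerm * σ, revPerm_mul_mem_avoiders.1 (hrr.symm ▸ hσ), by simp only [hrr, e]⟩

theorem perm_fin_three_cases : ∀ η : Equiv.Perm (Fin 3), η = 1 ∨ η = 1 * Fin.revPerm ∨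
    η = Equiv.swap 1 2 ∨ η = Equiv.swap 1 2 * Fin.revPerm ∨ η = Fin.revPerm * Equiv.swap 1 2 ∨
    η = Fin.revPerm * (Equiv.swap 1 2 * Fin.revPerm) := by
  decide

theorem hasBallotCode (η : Equiv.Perm (Fin 3)) : HasBallotCode η := by
  rcases perm_fin_three_cases η with rfl | rfl | rfl | rfl | rfl | rfl
  · exact hasBallotCode_one
  · exact hasBallotCode_one.mul_revPerm
  · exact hasBallotCode_swap
  · exact hasBallotCode_swap.mul_revPerm
  · exact hasBallotCode_swap.revPerm_mul
  · exact hasBallotCode_swap.mul_revPerm.revPerm_mul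

/-! ### Counting bounds -/

/-- The window for the alternating length is the window for the changes of the code, widened by the
coding error 3 on both sides. -/
theorem choose_sq_mul_le_ncard (η : Equiv.Perm (Fin 3)) (n k : ℕ) (hn : 3 ≤ n)
    (s : Set (Equiv.Perm (Fin n)))
    (hs : ∀ σ, 2 * k ≤ altLength σ + 4 → altLength σ ≤ 2 * k + 6 → σ ∈ s) :
    ((n - 3) / 2).choose k ^ 2 * 4 ^ ((n - 3) / 2) ≤ (avoiders n η ∩ s).ncard * n ^ 3 := by
  classical
  obtain ⟨n, rfl⟩ := Nat.exists_eq_add_of_le' (show 2 ≤ n by omega)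
  obtain ⟨code, -, h2, h3⟩ := hasBallotCode η n
  refine (choose_sq_mul_le_card_strongBallot _ k hn).trans (Nat.mul_le_mul_right _ ?_)
  rw [← Set.ncard_coe_finset]
  refine (Set.ncard_le_ncard ?_ (Set.toFinite _)).trans
    (Set.ncard_image_le (f := code) (Set.toFinite (avoiders (n + 2) η ∩ s)))
  intro p hp
  simp only [Finset.coe_filter, Set.mem_ofPred_eq] at hp
  obtain ⟨σ, hσ, rfl⟩ := h3 p hp.1 hp.2.1
  have := h2 σ hσ
  exact ⟨σ, ⟨hσ, hs σ (by omega) (by omega)⟩, rfl⟩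

theorem ncard_avoiders_le (η : Equiv.Perm (Fin 3)) (n : ℕ) (hn : 2 ≤ n) :
    (avoiders n η).ncard ≤ 4 ^ n := by
  obtain ⟨n, rfl⟩ := Nat.exists_eq_add_of_le' hn
  obtain ⟨code, h1, h2, -⟩ := hasBallotCode η n
  have := Set.ncard_le_ncard_of_injOn code (t := ↑(words (n + 2) ×ˢ words (n + 2)))
    (fun σ hσ => (h2 σ hσ).1) h1 (Finset.finite_toSet _)
  rw [Set.ncard_coe_finset, Finset.card_product, card_words] at this
  refine this.trans_eq ?_
  rw [← mul_pow]
  norm_num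

/-- Markov's inequality for `t` to the number of changes, with the sum over codes extended to all
pairs of words. Since `t` may be on either side of 1, both tails are covered; `c` has to allow for
the coding error. -/
theorem ncard_mul_le_of_chernoff (η : Equiv.Perm (Fin 3)) (n : ℕ) (hn : 2 ≤ n) {t c : ℝ}
    (ht : 0 < t) (s : Set (Equiv.Perm (Fin n)))
    (hs : ∀ σ ∈ s, ∀ j : ℕ, j ≤ altLength σ + 3 → altLength σ ≤ j + 3 → c ≤ t ^ j) :
    (avoiders n η ∩ s).ncard * c ≤ 2 ^ n * (2 * (1 + t) ^ n) := by
  classical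
  obtain ⟨n, rfl⟩ := Nat.exists_eq_add_of_le' hn
  obtain ⟨code, h1, h2, -⟩ := hasBallotCode η n
  have hfin : (avoiders (n + 2) η ∩ s).Finite := Set.toFinite _
  rw [Set.ncard_eq_toFinset_card _ hfin, ← nsmul_eq_mul]
  calc _ ≤ ∑ σ ∈ hfin.toFinset, t ^ chg (code σ).1 := by
        refine Finset.card_nsmul_le_sum _ _ _ fun σ hσ => ?_
        have hσ' := hfin.mem_toFinset.1 hσ
        have := h2 σ hσ'.1
        exact hs σ hσ'.2 _ this.2.1 this.2.2
    _ = ∑ p ∈ hfin.toFinset.image code, t ^ chg p.1 := by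
        rw [Finset.sum_image]
        intro σ hσ τ hτ e
        exact h1 (hfin.mem_toFinset.1 hσ).1 (hfin.mem_toFinset.1 hτ).1 e
    _ ≤ ∑ p ∈ words (n + 2) ×ˢ words (n + 2), t ^ chg p.1 := by
        refine Finset.sum_le_sum_of_subset_of_nonneg ?_ fun _ _ _ => by positivity
        intro p hp
        obtain ⟨σ, hσ, rfl⟩ := Finset.mem_image.1 hp
        exact (h2 σ (hfin.mem_toFinset.1 hσ).1).1
    _ = 2 ^ (n + 2) * (2 * (1 + t) ^ (n + 1)) := by
        rw [Finset.sum_product_right]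
        simp only [sum_words_succ_pow_chg, Finset.sum_const, card_words, nsmul_eq_mul]
        push_cast; ring
    _ ≤ _ := by
        gcongr
        · linarith
        · omega

/-! ### Asymptotics -/

/-- Up to the factor `m ^ m`, these are the binomial probabilities with success parameter `k / m`,
whose mode is `k`. Ratios of consecutive terms show that they rise up to `k` and fall afterwards. -/
theorem choose_mul_pow_le {m k : ℕ} (hk : k ≤ m) {j : ℕ} (hj : j ≤ m) :
    k ^ j * (m - k) ^ (m - j) * m.choose j ≤ k ^ k * (m - k) ^ (m - k) * m.choose k := by
  set f : ℕ → ℕ := fun j => k ^ j * (m - k) ^ (m - j) * m.choose j with hf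
  have step : ∀ j < m, f (j + 1) * (j + 1) = (k ^ j * (m - k) ^ (m - j - 1) * m.choose j) *
      ((m - j) * k) ∧ f j * (j + 1) = (k ^ j * (m - k) ^ (m - j - 1) * m.choose j) *
      ((j + 1) * (m - k)) := by
    intro j hj
    have h1 := Nat.choose_succ_right_eq m j
    constructor
    · simp only [hf]
      rw [mul_assoc, h1, Nat.sub_sub, pow_succ]
      ring
    · simp only [hf]
      obtain ⟨d, hd⟩ := Nat.exists_eq_add_of_lt hj
      rw [show m - j = (m - j - 1) + 1 by omega, pow_succ, Nat.add_sub_cancel]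
      ring
  have up : ∀ j < k, f j ≤ f (j + 1) := by
    intro j hj
    obtain ⟨h1, h2⟩ := step j (by omega)
    refine le_of_mul_le_mul_right ?_ (Nat.succ_pos j)
    rw [h1, h2]
    refine Nat.mul_le_mul_left _ ?_
    rw [mul_comm (m - j)]
    exact Nat.mul_le_mul (by omega) (by omega)
  have down : ∀ j, k ≤ j → j < m → f (j + 1) ≤ f j := by
    intro j hj hjm
    obtain ⟨h1, h2⟩ := step j hjm
    refine le_of_mul_le_mul_right ?_ (Nat.succ_pos j)
    rw [h1, h2]
    refine Nat.mul_le_mul_left _ ?_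
    rw [mul_comm (m - j)]
    exact Nat.mul_le_mul (by omega) (by omega)
  show f j ≤ f k
  rcases le_total j k with h | h
  · have : ∀ i, j ≤ i → i ≤ k → f j ≤ f i := by
      intro i hi
      induction i, hi using Nat.le_induction with
      | base => intro _; exact le_rfl
      | succ i _ ih => intro hik; exact (ih (by omega)).trans (up i hik)
    exact this k h le_rfl
  · have : ∀ i, k ≤ i → i ≤ m → f i ≤ f k := by
      intro i hi
      induction i, hi using Nat.le_induction with
      | base => intro _; exact le_rfl
      | succ i hki ih => intro hik; exact (down i hki hik).trans (ih (by omega))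
    exact this j h hj

theorem pow_self_le_mul_choose {m k : ℕ} (hk : k ≤ m) :
    m ^ m ≤ (m + 1) * (k ^ k * (m - k) ^ (m - k) * m.choose k) := by
  have := add_pow k (m - k) m
  rw [Nat.add_sub_cancel' hk] at this
  rw [this]
  refine (Finset.sum_le_card_nsmul _ _ _ fun j hj => choose_mul_pow_le hk
    (Nat.lt_succ_iff.1 (Finset.mem_range.1 hj))).trans_eq ?_
  simp

/-- The largest of the `m + 1` binomial probabilities is at least their average, so no form of
Stirling's formula is needed. -/
theorem binEntropy_mul_le_log_choose {m k : ℕ} (hk0 : 0 < k) (hkm : k < m) :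
    m * Real.binEntropy (k / m) - Real.log (m + 1) ≤ Real.log (m.choose k) := by
  have hm : (0 : ℝ) < m := by exact_mod_cast hk0.trans hkm
  have hk : (0 : ℝ) < k := by exact_mod_cast hk0
  have hmk : (0 : ℝ) < (m : ℝ) - k := by rw [sub_pos]; exact_mod_cast hkm
  have hc : (0 : ℝ) < m.choose k := by exact_mod_cast Nat.choose_pos hkm.le
  have h : (m : ℝ) ^ m ≤ (m + 1) * (k ^ k * ((m : ℝ) - k) ^ (m - k) * m.choose k) := by
    have := pow_self_le_mul_choose hkm.le
    rw [← Nat.cast_sub hkm.le]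
    exact_mod_cast this
  have h' := Real.log_le_log (by positivity) h
  rw [Real.log_mul (by positivity) (by positivity), Real.log_mul (by positivity) hc.ne',
    Real.log_mul (by positivity) (by positivity), Real.log_pow, Real.log_pow, Real.log_pow,
    Nat.cast_sub hkm.le] at h'
  have e : (m : ℝ) * Real.binEntropy (k / m) =
      m * Real.log m - k * Real.log k - (m - k) * Real.log (m - k) := by
    rw [Real.binEntropy, show (1 : ℝ) - k / m = (m - k) / m by field_simp, inv_div, inv_div,
      Real.log_div hm.ne' hk.ne', Real.log_div hm.ne' hmk.ne']
    field_simp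
    ring
  linarith

theorem tendsto_div_of_abs_sub_le {u : ℕ → ℝ} {a C : ℝ}
    (h : ∀ᶠ n : ℕ in atTop, |u n - n * a| ≤ C) :
    Tendsto (fun n : ℕ => u n / n) atTop (𝓝 a) := by
  rw [tendsto_iff_norm_sub_tendsto_zero]
  refine squeeze_zero' (Eventually.of_forall fun _ => norm_nonneg _) ?_
    (tendsto_const_div_atTop_nhds_zero_nat C)
  filter_upwards [h, eventually_gt_atTop 0] with n hn hn0
  have : (0 : ℝ) < n := by exact_mod_cast hn0
  rw [Real.norm_eq_abs, show u n / n - a = (u n - n * a) / n by field_simp, abs_div,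
    abs_of_pos this]
  gcongr

theorem tendsto_log_div_nat : Tendsto (fun n : ℕ => Real.log n / n) atTop (𝓝 0) :=
  (Real.isLittleO_log_id_atTop.tendsto_div_nhds_zero).comp tendsto_natCast_atTop_atTop

/-- With `m` near `n / 2` and `k` near `n * x / 2`, the ratio `k / m` tends to `x`, and `m.choose k
^ 2 * 4 ^ m` has exponent `binEntropy x + log 2`. -/
theorem exists_tendsto_le_log_ncard (η : Equiv.Perm (Fin 3)) {x : ℝ} (hx0 : 0 < x) (hx1 : x < 1)
    (s : ∀ n, Set (Equiv.Perm (Fin n))) (k : ℕ → ℕ) (C : ℝ)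
    (hk : ∀ᶠ n : ℕ in atTop, |(k n : ℝ) - n * (x / 2)| ≤ C)
    (hs : ∀ᶠ n : ℕ in atTop, ∀ σ : Equiv.Perm (Fin n), 2 * k n ≤ altLength σ + 4 →
      altLength σ ≤ 2 * k n + 6 → σ ∈ s n) :
    ∃ l : ℕ → ℝ, Tendsto l atTop (𝓝 (Real.binEntropy x + Real.log 2)) ∧
      ∀ᶠ n : ℕ in atTop, 0 < (avoiders n η ∩ s n).ncard ∧
        l n ≤ 1 / n * Real.log (avoiders n η ∩ s n).ncard := by
  set m : ℕ → ℕ := fun n => (n - 3) / 2 with hm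
  have hmn : Tendsto (fun n : ℕ => (m n : ℝ) / n) atTop (𝓝 (1 / 2)) := by
    refine tendsto_div_of_abs_sub_le (C := 3) ?_
    filter_upwards [eventually_ge_atTop 3] with n hn
    have h1 : n ≤ 2 * m n + 4 := by simp only [hm]; omega
    have h2 : 2 * m n ≤ n := by simp only [hm]; omega
    have h1' : (n : ℝ) ≤ 2 * m n + 4 := by exact_mod_cast h1
    have h2' : (2 : ℝ) * m n ≤ n := by exact_mod_cast h2
    rw [abs_le]; constructor <;> linarith
  have hkn : Tendsto (fun n : ℕ => (k n : ℝ) / n) atTop (𝓝 (x / 2)) :=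
    tendsto_div_of_abs_sub_le hk
  have hkm : Tendsto (fun n : ℕ => (k n : ℝ) / m n) atTop (𝓝 x) := by
    have := hkn.div hmn (by norm_num)
    rw [show x / 2 / (1 / 2) = x by ring] at this
    refine this.congr' ?_
    filter_upwards [eventually_gt_atTop 0] with n hn
    have : (0 : ℝ) < n := by exact_mod_cast hn
    simp only [Pi.div_apply]
    rw [div_div_div_cancel_right₀ this.ne']
  -- Of the five terms `log n`, three come from the factor `n ^ 3` and two from the entropy bound
  -- for the squared binomial coefficient.
  refine ⟨fun n => (m n : ℝ) / n * (2 * Real.binEntropy (k n / m n) + Real.log 4) -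
    5 * (Real.log n / n), ?_, ?_⟩
  · have h1 := (Real.binEntropy_continuous.tendsto x).comp hkm
    have h2 := (hmn.mul ((h1.const_mul 2).add_const (Real.log 4))).sub
      (tendsto_log_div_nat.const_mul 5)
    have e : (1 / 2 : ℝ) * (2 * Real.binEntropy x + Real.log 4) - 5 * 0 =
        Real.binEntropy x + Real.log 2 := by
      rw [show (4 : ℝ) = 2 ^ 2 by norm_num, Real.log_pow]
      push_cast; ring
    rw [e] at h2
    exact h2
  · filter_upwards [hs, eventually_ge_atTop 3, hkm.eventually (lt_mem_nhds hx0),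
      hkm.eventually (gt_mem_nhds hx1), hmn.eventually (lt_mem_nhds (by norm_num : (0:ℝ) < 1 / 2))]
      with n hs hn h0 h1 h2
    have hn0 : (0 : ℝ) < n := by exact_mod_cast (show 0 < n by omega)
    have hm0 : (0 : ℝ) < m n := by
      rcases (Nat.cast_nonneg (α := ℝ) (m n)).lt_or_eq with h | h
      · exact h
      · rw [← h] at h2; simp at h2
    have hk0 : 0 < k n := by
      rw [div_pos_iff_of_pos_right hm0] at h0
      exact_mod_cast h0
    have hk1 : k n < m n := by
      rw [div_lt_one hm0] at h1
      exact_mod_cast h1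
    have key := choose_sq_mul_le_ncard η n (k n) hn (s n) hs
    have hc : 0 < (m n).choose (k n) := Nat.choose_pos hk1.le
    have hpos : 0 < (avoiders n η ∩ s n).ncard := by
      by_contra hz
      rw [Nat.eq_zero_of_not_pos hz, zero_mul] at key
      have : 0 < (m n).choose (k n) ^ 2 * 4 ^ m n := by positivity
      exact absurd key (not_le.2 this)
    refine ⟨hpos, ?_⟩
    have key' : ((m n).choose (k n) : ℝ) ^ 2 * 4 ^ m n ≤ (avoiders n η ∩ s n).ncard * n ^ 3 := by
      exact_mod_cast key
    have hc' : (0 : ℝ) < (m n).choose (k n) := by exact_mod_cast hc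
    have hpos' : (0 : ℝ) < (avoiders n η ∩ s n).ncard := by exact_mod_cast hpos
    have hlog := Real.log_le_log (by positivity) key'
    rw [Real.log_mul (by positivity) (by positivity), Real.log_mul (by positivity) (by positivity),
      Real.log_pow, Real.log_pow, Real.log_pow] at hlog
    have hb := binEntropy_mul_le_log_choose hk0 hk1
    have hmlog : Real.log (m n + 1) ≤ Real.log n := by
      refine Real.log_le_log (by positivity) ?_
      have : m n + 1 ≤ n := by simp only [hm]; omega
      exact_mod_cast this
    push_cast at hlog
    have e : (m n : ℝ) / n * (2 * Real.binEntropy (k n / m n) + Real.log 4) -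
        5 * (Real.log n / n) = 1 / n * (2 * (m n * Real.binEntropy (k n / m n)) +
          m n * Real.log 4 - 5 * Real.log n) := by
      field_simp
    rw [e]
    refine mul_le_mul_of_nonneg_left ?_ (by positivity)
    linarith

/-- The lower bound is the case `x = 1 / 2`, where the entropy is maximal, so the Catalan numbers
are not needed. -/
theorem tendsto_log_ncard_avoiders (η : Equiv.Perm (Fin 3)) :
    (∀ᶠ n : ℕ in atTop, 0 < (avoiders n η).ncard) ∧
      Tendsto (fun n : ℕ => 1 / (n : ℝ) * Real.log (avoiders n η).ncard) atTop
        (𝓝 (Real.log 4)) := by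
  obtain ⟨l, hl, h⟩ := exists_tendsto_le_log_ncard η (x := 1 / 2) (by norm_num) (by norm_num)
    (fun _ => Set.univ) (fun n => n / 4) 1
    (Eventually.of_forall fun n => by
      have h1 : n ≤ 4 * (n / 4) + 4 := by omega
      have h2 : 4 * (n / 4) ≤ n := by omega
      have h1' : (n : ℝ) ≤ 4 * (n / 4 : ℕ) + 4 := by exact_mod_cast h1
      have h2' : (4 : ℝ) * (n / 4 : ℕ) ≤ n := by exact_mod_cast h2
      rw [abs_le]; constructor <;> linarith)
    (Eventually.of_forall fun n σ _ _ => Set.mem_univ σ)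
  simp only [Set.inter_univ] at h
  have e : Real.binEntropy (1 / 2) + Real.log 2 = Real.log 4 := by
    rw [one_div, Real.binEntropy_two_inv, show (4 : ℝ) = 2 ^ 2 by norm_num, Real.log_pow]
    push_cast; ring
  rw [e] at hl
  refine ⟨h.mono fun n hn => hn.1, tendsto_of_tendsto_of_tendsto_of_le_of_le' hl
    tendsto_const_nhds (h.mono fun n hn => hn.2) ?_⟩
  filter_upwards [h, eventually_ge_atTop 2] with n hn hn2
  have hn0 : (0 : ℝ) < n := by exact_mod_cast (show 0 < n by omega)
  have h4 : ((avoiders n η).ncard : ℝ) ≤ 4 ^ n := by exact_mod_cast ncard_avoiders_le η n hn2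
  have := Real.log_le_log (by exact_mod_cast hn.1) h4
  rw [Real.log_pow] at this
  rw [one_div, inv_mul_le_iff₀ hn0]
  exact this

theorem exists_tendsto_log_ncard_le (η : Equiv.Perm (Fin 3)) {x : ℝ} (hx0 : 0 < x) (hx1 : x < 1)
    (s : ∀ n, Set (Equiv.Perm (Fin n))) (δ : ℝ)
    (hs : ∀ n, ∀ σ ∈ s n, ∀ j : ℕ, j ≤ altLength σ + 3 → altLength σ ≤ j + 3 →
      (x / (1 - x)) ^ (n * x + δ) ≤ (x / (1 - x)) ^ j) :
    ∃ u : ℕ → ℝ, Tendsto u atTop (𝓝 (Real.binEntropy x + Real.log 2)) ∧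
      ∀ᶠ n : ℕ in atTop, 0 < (avoiders n η ∩ s n).ncard →
        1 / n * Real.log (avoiders n η ∩ s n).ncard ≤ u n := by
  have hx1' : 0 < 1 - x := sub_pos.2 hx1
  set t := x / (1 - x) with ht
  have ht0 : 0 < t := div_pos hx0 hx1'
  -- The value of `t` is the minimizer of `log (1 + t) - x * log t`, and the minimum is `binEntropy
  -- x`.
  refine ⟨fun n => (Real.log 2 + Real.log (1 + t) - x * Real.log t) +
    (Real.log 2 - δ * Real.log t) / n, ?_, ?_⟩
  · have := (tendsto_const_div_atTop_nhds_zero_nat (Real.log 2 - δ * Real.log t)).const_add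
      (Real.log 2 + Real.log (1 + t) - x * Real.log t)
    convert this using 2
    have e : 1 + t = (1 - x)⁻¹ := by rw [ht]; field_simp; ring
    rw [e, ht, Real.log_div hx0.ne' hx1'.ne', Real.binEntropy, Real.log_inv, Real.log_inv]
    ring
  · filter_upwards [eventually_ge_atTop 2] with n hn hpos
    have hn0 : (0 : ℝ) < n := by exact_mod_cast (show 0 < n by omega)
    have hpos' : (0 : ℝ) < (avoiders n η ∩ s n).ncard := by exact_mod_cast hpos
    have key := ncard_mul_le_of_chernoff η n hn ht0 (s n) (hs n)
    have htp := Real.rpow_pos_of_pos ht0 (n * x + δ)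
    have hlog := Real.log_le_log (by positivity) key
    rw [Real.log_mul hpos'.ne' htp.ne', Real.log_rpow ht0, Real.log_mul (by positivity)
      (by positivity), Real.log_mul (by positivity) (by positivity), Real.log_pow, Real.log_pow]
      at hlog
    rw [one_div, inv_mul_le_iff₀ hn0]
    have e : (n : ℝ) * ((Real.log 2 + Real.log (1 + t) - x * Real.log t) +
        (Real.log 2 - δ * Real.log t) / n) = n * Real.log 2 + n * Real.log (1 + t) -
          n * x * Real.log t + (Real.log 2 - δ * Real.log t) := by
      field_simp
    rw [e]
    linarith

theorem hasExpDecayRate_probAv (η : Equiv.Perm (Fin 3)) {x : ℝ} (hx0 : 0 < x) (hx1 : x < 1)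
    (s : ∀ n, Set (Equiv.Perm (Fin n))) (k : ℕ → ℕ) (C δ : ℝ)
    (hk : ∀ᶠ n : ℕ in atTop, |(k n : ℝ) - n * (x / 2)| ≤ C)
    (hs : ∀ᶠ n : ℕ in atTop, ∀ σ : Equiv.Perm (Fin n), 2 * k n ≤ altLength σ + 4 →
      altLength σ ≤ 2 * k n + 6 → σ ∈ s n)
    (hs' : ∀ n, ∀ σ ∈ s n, ∀ j : ℕ, j ≤ altLength σ + 3 → altLength σ ≤ j + 3 →
      (x / (1 - x)) ^ (n * x + δ) ≤ (x / (1 - x)) ^ j) :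
    HasExpDecayRate (fun n => probAv n η (s n)) (rateAlt x) := by
  obtain ⟨l, hl, h1⟩ := exists_tendsto_le_log_ncard η hx0 hx1 s k C hk hs
  obtain ⟨u, hu, h2⟩ := exists_tendsto_log_ncard_le η hx0 hx1 s δ hs'
  obtain ⟨h3, h4⟩ := tendsto_log_ncard_avoiders η
  have hlim := tendsto_of_tendsto_of_tendsto_of_le_of_le' hl hu (h1.mono fun n hn => hn.2)
    ((h1.and h2).mono fun n hn => hn.2 hn.1.1)
  have e : -rateAlt x = Real.binEntropy x + Real.log 2 - Real.log 4 := by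
    rw [rateAlt, Real.binEntropy, show (4 : ℝ) = 2 ^ 2 by norm_num, Real.log_pow, Real.log_inv,
      Real.log_inv]
    push_cast; ring
  simp only [HasExpDecayRate, probAv_eq_ncard_div]
  refine ⟨?_, ?_⟩
  · filter_upwards [h1, h3] with n hn hn'
    exact div_pos (by exact_mod_cast hn.1) (by exact_mod_cast hn')
  · rw [e]
    refine (hlim.sub h4).congr' ?_
    filter_upwards [h1, h3] with n hn hn'
    rw [Real.log_div (by exact_mod_cast hn.1.ne') (by exact_mod_cast hn'.ne'), mul_sub]

/-! ### The upper and the lower tail -/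

theorem abs_floor_add_sub_le {y : ℝ} (hy : 0 ≤ y) : |((⌊y⌋₊ + 3 : ℕ) : ℝ) - y| ≤ 4 := by
  have h1 := Nat.floor_le hy
  have h2 := Nat.lt_floor_add_one y
  push_cast
  rw [abs_le]
  constructor <;> linarith

theorem hasExpDecayRate_of_ge_half (η : Equiv.Perm (Fin 3)) {x : ℝ}
    (hx : x ∈ Set.Ico (1 / 2 : ℝ) 1) (s : ∀ n, Set (Equiv.Perm (Fin n)))
    (hlt : ∀ n, ∀ σ : Equiv.Perm (Fin n), (n : ℝ) * x < altLength σ → σ ∈ s n)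
    (hle : ∀ n, ∀ σ ∈ s n, (n : ℝ) * x ≤ altLength σ) :
    HasExpDecayRate (fun n => probAv n η (s n)) (rateAlt x) := by
  have hx0 : 0 < x := by linarith [hx.1]
  have hx1 : 0 < 1 - x := sub_pos.2 hx.2
  -- With the shift 3, the lower end `2 * k - 4` of the window is already above `n * x`. The
  -- Chernoff parameter is at least 1 here, so an exponent bounded below, by `n * x - 3`, is what is
  -- needed.
  refine hasExpDecayRate_probAv η hx0 hx.2 s (fun n => ⌊(n : ℝ) * (x / 2)⌋₊ + 3) 4 (-3)
    (Eventually.of_forall fun n => abs_floor_add_sub_le (by positivity))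
    (Eventually.of_forall fun n σ h _ => hlt n σ ?_) fun n σ hσ j _ h2 => ?_
  · have h1 := Nat.lt_floor_add_one ((n : ℝ) * (x / 2))
    have h' : (2 : ℝ) * (⌊(n : ℝ) * (x / 2)⌋₊ + 3) ≤ altLength σ + 4 := by exact_mod_cast h
    linarith
  · rw [← Real.rpow_natCast]
    refine Real.rpow_le_rpow_of_exponent_le ?_ ?_
    · rw [le_div_iff₀ hx1]; linarith [hx.1]
    · have h2' : (altLength σ : ℝ) ≤ j + 3 := by exact_mod_cast h2
      linarith [hle n σ hσ]

theorem hasExpDecayRate_of_le_half (η : Equiv.Perm (Fin 3)) {x : ℝ}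
    (hx : x ∈ Set.Ioc (0 : ℝ) (1 / 2)) (s : ∀ n, Set (Equiv.Perm (Fin n)))
    (hlt : ∀ n, ∀ σ : Equiv.Perm (Fin n), (altLength σ : ℝ) < n * x → σ ∈ s n)
    (hle : ∀ n, ∀ σ ∈ s n, (altLength σ : ℝ) ≤ n * x) :
    HasExpDecayRate (fun n => probAv n η (s n)) (rateAlt x) := by
  have hx0 : 0 < x := hx.1
  have hx1 : 0 < 1 - x := by linarith [hx.2]
  have hlarge : ∀ᶠ n : ℕ in atTop, 4 ≤ ⌊(n : ℝ) * (x / 2)⌋₊ :=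
    (tendsto_nat_floor_atTop.comp (tendsto_natCast_atTop_atTop.atTop_mul_const
      (show 0 < x / 2 by positivity))).eventually_ge_atTop 4
  -- With the shift 4, the upper end `2 * k + 6` of the window is below `n * x`; the floor is
  -- eventually at least 4, so the subtraction is not truncated. The Chernoff parameter is at most 1
  -- here, so the exponent is bounded above, by `n * x + 3`.
  refine hasExpDecayRate_probAv η hx0 (by linarith [hx.2]) s
    (fun n => ⌊(n : ℝ) * (x / 2)⌋₊ - 4) 5 3 (hlarge.mono fun n hn => ?_)
    (hlarge.mono fun n hn σ _ h => hlt n σ ?_) fun n σ hσ j h1 _ => ?_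
  · have h1 := Nat.floor_le (show 0 ≤ (n : ℝ) * (x / 2) by positivity)
    have h2 := Nat.lt_floor_add_one ((n : ℝ) * (x / 2))
    rw [Nat.cast_sub hn, abs_le]
    push_cast
    constructor <;> linarith
  · have h1 := Nat.floor_le (show 0 ≤ (n : ℝ) * (x / 2) by positivity)
    have h' : altLength σ + 2 ≤ 2 * ⌊(n : ℝ) * (x / 2)⌋₊ := by omega
    have h'' : (altLength σ : ℝ) + 2 ≤ 2 * ⌊(n : ℝ) * (x / 2)⌋₊ := by exact_mod_cast h'
    linarith
  · rw [← Real.rpow_natCast]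
    refine Real.rpow_le_rpow_of_exponent_ge (by positivity) ?_ ?_
    · rw [div_le_one hx1]; linarith [hx.2]
    · have h1' : (j : ℝ) ≤ altLength σ + 3 := by exact_mod_cast h1
      linarith [hle n σ hσ]

theorem theorem1p1 (η : Equiv.Perm (Fin 3)) :
    (∀ x : ℝ, x ∈ Set.Ico (1 / 2 : ℝ) 1 →
      HasExpDecayRate (fun n => probAv n η {σ | (n : ℝ) * x ≤ (altLength σ : ℝ)}) (rateAlt x) ∧
      HasExpDecayRate (fun n => probAv n η {σ | (n : ℝ) * x < (altLength σ : ℝ)}) (rateAlt x)) ∧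
    (∀ x : ℝ, x ∈ Set.Ioc (0 : ℝ) (1 / 2) →
      HasExpDecayRate (fun n => probAv n η {σ | (altLength σ : ℝ) ≤ (n : ℝ) * x}) (rateAlt x) ∧
      HasExpDecayRate (fun n => probAv n η {σ | (altLength σ : ℝ) < (n : ℝ) * x}) (rateAlt x)) :=
  ⟨fun _ hx => ⟨hasExpDecayRate_of_ge_half η hx _ (fun _ _ h => h.le) fun _ _ h => h,
      hasExpDecayRate_of_ge_half η hx _ (fun _ _ h => h) fun _ _ h => le_of_lt h⟩,
    fun _ hx => ⟨hasExpDecayRate_of_le_half η hx _ (fun _ _ h => h.le) fun _ _ h => h,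
      hasExpDecayRate_of_le_half η hx _ (fun _ _ h => h) fun _ _ h => le_of_lt h⟩⟩
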